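/- Let $m_1\le\dots\le m_n$ be integers with $i\le m_i\le n$, and let $P$ be the natural unit interval order on $[n]$: $i<_P j$ iff $m_i<j$. Two distinct elements are adjacent in the graph $\mathrm{inc}(P)$ if they are incomparable in $P$. **Heaps.** For $\mu=(\mu_1,\dots,\mu_n)\in\mathbb N^n$ let $P^\mu$ be the graph on the vertices (blocks) $v_{a,i}$ ($a\in[n]$, $1\le i\le\mu_a$) in which distinct $v_{a,i},v_{b,j}$ are adjacent iff $a=b$ or $a,b$ are incomparable in $P$. A *heap of $P$ of type $\mu$* is an acyclic orientation $H$ of $P^\mu$ in which the edge between $v_{a,i}$ and $v_{a,j}$, $i<j$, points to $v_{a,i}$. A *sink* is a block without outgoing edge, and $\mathrm{asc}_P(H)$ is the number of edges that point from some $v_{b,j}$ to some $v_{a,i}$ with $a>b$. Let $W(H)$ be the set of words obtained by listing the blocks so that every edge points to the block listed first, and recording the index $a$ of each block $v_{a,i}$. There is a unique word $w_H=w_1\cdots w_d\in W(H)$ with no $i$ such that $w_i>_P w_{i+1}$. **Noncommutative functions.** In $\mathcal U=\mathbb Z\langle u_1,\dots,u_n\rangle$ put $u_w=u_{w_1}\cdots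 u_{w_d}$ for a word $w=w_1\cdots w_d$, and let $\mathcal I_P$ be the two-sided ideal generated by $u_au_c-u_cu_a$ ($a<_Pc$) and $u_au_cu_b-u_bu_au_c$ ($a<b<c$, $a\not<_Pb$, $b\not<_Pc$, $a<_Pc$). Let $\mathfrak e_k(u)=\sum_{i_1>_P\cdots>_P i_k}u_{i_1}\cdots u_{i_k}$, $\mathfrak e_\nu(u)=\mathfrak e_{\nu_1}(u)\mathfrak e_{\nu_2}(u)\cdots$ for a partition $\nu=(\nu_1\ge\nu_2\ge\cdots)$, and $\mathfrak m_\lambda(u)=\sum_\nu N_{\lambda,\nu}\,\mathfrak e_\nu(u)$, where the integers $N_{\lambda,\nu}$ are given by the expansion $m_\lambda(x)=\sum_\nu N_{\lambda,\nu}e_\nu(x)$ of the monomial symmetric function in elementary symmetric functions. **Chromatic quasisymmetric function.** Let $X_P(x,q;\mu)=\sum_\kappa q^{\mathrm{asc}(\kappa)}\prod_{i}\prod_{r\in\kappa(i)}x_r$, where $\kappa$ ranges over the maps from $[n]$ to the finite subsets of $\{1,2,\dots\}$ with $|\kappa(i)|=\mu_i$ for all $i$ and $\kappa(i)\cap\kappa(j)=\emptyset$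 whenever $i,j$ are adjacent in $\mathrm{inc}(P)$, and $\mathrm{asc}(\kappa)$ is the number of pairs $((i,r),(j,s))$ with $i,j$ adjacent in $\mathrm{inc}(P)$, $i<j$, $r\in\kappa(i)$, $s\in\kappa(j)$ and $r<s$. **Theorem.** Let $k\ge1$. 1. For every $d\ge1$, $$\sum_{\lambda\vdash d,\ \ell(\lambda)=k}\mathfrak m_\lambda(u)\equiv\sum_H u_{w_H}\pmod{\mathcal I_P},$$ where $H$ ranges over all heaps of $P$ (of any type) with $d$ blocks and exactly $k$ sinks. 2. For every $\mu\in\mathbb N^n$ there is a unique expansion $X_P(x,q;\mu)=\sum_\lambda c_\lambda(q)e_\lambda(x)$ with $c_\lambda(q)\in\mathbb Q[q]$, all but finitely many of them zero, and $$\sum_{\ell(\lambda)=k}c_\lambda(q)=\sum_H q^{\mathrm{asc}_P(H)},$$ where $H$ ranges over all heaps of $P$ of type $\mu$ with exactly $k$ sinks. -/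

import Mathlib

/-! ## Natural unit interval orders -/

/-- The data `m = (m_1 ≤ ⋯ ≤ m_n)`, `i ≤ m_i ≤ n`, of a natural unit interval order on the set
`{1, …, n}`, which is represented by `Fin n` (all labels and all values `m_i` are shifted by one). -/
structure NatUnitIntervalOrder (n : ℕ) where
  m : Fin n → Fin n
  mono : Monotone m
  le_m : ∀ i, i ≤ m i

namespace NatUnitIntervalOrder

variable {n : ℕ} (P : NatUnitIntervalOrder n)

/-- The strict order `i <_P j`, which means `m_i < j`. -/
def lt (i j : Fin n) : Prop := P.m i < j

theorem lt_imp_lt {P : NatUnitIntervalOrder n} {i j : Fin n} (h : P.lt i j) : i < j :=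
  lt_of_le_of_lt (P.le_m i) h

theorem lt_irrefl (i : Fin n) : ¬ P.lt i i := fun h => (lt_imp_lt h).false

theorem lt_trans {P : NatUnitIntervalOrder n} {i j k : Fin n} (h : P.lt i j) (h' : P.lt j k) :
    P.lt i k :=
  _root_.lt_trans h (lt_imp_lt h')

/-- The incomparability graph of `P`. -/
def inc : SimpleGraph (Fin n) where
  Adj a b := a ≠ b ∧ ¬ P.lt a b ∧ ¬ P.lt b a
  symm := ⟨fun _ _ h => ⟨h.1.symm, h.2.2, h.2.1⟩⟩
  loopless := ⟨fun _ h => h.1 rfl⟩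

end NatUnitIntervalOrder

/-! ## Symmetric functions -/

section SymmetricFunctions

variable (σ : Type*) (R : Type*) [CommRing R]

open Classical in
/-- The elementary symmetric function `e_k` in the variables `x_i`, `i ∈ σ`: the sum of all
squarefree monomials of degree `k`. -/
noncomputable def elemSymm (k : ℕ) : MvPowerSeries σ R :=
  fun s => if s.degree = k ∧ ∀ i, s i ≤ 1 then 1 else 0

/-- `e_λ = e_{λ_1} e_{λ_2} ⋯`. -/
noncomputable def elemSymmPart {d : ℕ} (l : d.Partition) : MvPowerSeries σ R :=
  (l.parts.map (elemSymm σ R)).prod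

open Classical in
/-- The monomial symmetric function `m_λ` in the variables `x_i`, `i ∈ σ`: the sum of all monomials
whose nonzero exponents are, in some order, the parts of `λ`. -/
noncomputable def monoSymm {d : ℕ} (l : d.Partition) : MvPowerSeries σ R :=
  fun s => if s.support.val.map s = l.parts then 1 else 0

end SymmetricFunctions

/-- The exponent vector of `e_ν` as a monomial in `e_1, …, e_d`: the index `i : Fin d`, which stands
for `e_{i+1}`, is sent to the number of parts of `ν` equal to `i + 1`. -/
noncomputable def partExponent {d : ℕ} (ν : d.Partition) : Fin d →₀ ℕ :=
  Finsupp.equivFunOnFinite.symm fun i => ν.parts.count (i.1 + 1)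

/-- The coefficients `N_{λ,ν}` in `m_λ = ∑_{ν ⊢ d} N_{λ,ν} e_ν`, for `λ ⊢ d`. They are read off from
the (unique) expression of `m_λ(x_1, …, x_d)` as a polynomial in `e_1, …, e_d`. That the expansion
then holds in infinitely many variables is `monoSymm_eq_sum` below. -/
noncomputable def monoToElem {d : ℕ} (l ν : d.Partition) : ℤ :=
  ((MvPolynomial.esymmAlgEquiv (Fin d) ℤ (Fintype.card_fin d)).symm
    ⟨MvPolynomial.msymm (Fin d) ℤ l, MvPolynomial.msymm_isSymmetric (Fin d) ℤ l⟩).coeff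
      (partExponent ν)

section Expansion

open MvPolynomial

theorem coeff_elemSymm (σ R : Type*) [CommRing R] (k : ℕ) (s : σ →₀ ℕ)
    [Decidable (s.degree = k ∧ ∀ i, s i ≤ 1)] :
    MvPowerSeries.coeff s (elemSymm σ R k) = if s.degree = k ∧ ∀ i, s i ≤ 1 then 1 else 0 := by
  change (@ite _ _ (_) _ _) = _
  split_ifs <;> rfl

theorem coeff_monoSymm (σ R : Type*) [CommRing R] {d : ℕ} (l : d.Partition) (s : σ →₀ ℕ)
    [Decidable (s.support.val.map s = l.parts)] :
    MvPowerSeries.coeff s (monoSymm σ R l) = if s.support.val.map s = l.parts then 1 else 0 := by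
  change (@ite _ _ (_) _ _) = _
  split_ifs <;> rfl

theorem esymm_coe_eq_elemSymm (d k : ℕ) :
    ((esymm (Fin d) ℤ k : MvPolynomial (Fin d) ℤ) : MvPowerSeries (Fin d) ℤ)
      = elemSymm (Fin d) ℤ k := by
  classical
  ext s
  have hval : ∀ (t : Finset (Fin d)) j,
      (∑ i ∈ t, Finsupp.single i 1 : Fin d →₀ ℕ) j = if j ∈ t then 1 else 0 := by
    intro t j
    simp [Finsupp.finsetSum_apply, Finsupp.single_apply]
  have hdeg : ∀ t : Finset (Fin d), (∑ i ∈ t, Finsupp.single i 1 : Fin d →₀ ℕ).degree = t.card := by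
    intro t
    simp [map_sum]
  rw [coeff_coe, esymm_eq_sum_monomial, coeff_sum, coeff_elemSymm]
  simp only [coeff_monomial]
  split_ifs with h
  · have hs : (∑ i ∈ s.support, Finsupp.single i 1 : Fin d →₀ ℕ) = s := by
      ext j
      rw [hval]
      have := h.2 j
      split_ifs with hj
      · rw [Finsupp.mem_support_iff] at hj; omega
      · rw [Finsupp.notMem_support_iff] at hj; exact hj.symm
    rw [Finset.sum_eq_single s.support]
    · simp [hs]
    · intro t _ ht
      rw [if_neg]
      rintro rfl
      apply ht
      ext j
      rw [Finsupp.mem_support_iff, hval]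
      simp
    · intro hn
      exfalso; apply hn
      rw [Finset.mem_powersetCard_univ, ← hdeg, hs, h.1]
  · refine Finset.sum_eq_zero fun t ht => if_neg ?_
    rintro rfl
    apply h
    refine ⟨by rw [hdeg]; exact Finset.mem_powersetCard_univ.mp ht, fun i => ?_⟩
    rw [hval]; split_ifs <;> simp

theorem prod_X_eq_monomial {d : ℕ} (a : Multiset (Fin d)) :
    (a.map (X : Fin d → MvPolynomial (Fin d) ℤ)).prod = monomial a.toFinsupp 1 := by
  induction a using Multiset.induction_on with
  | empty => simp
  | cons i a ih =>
    rw [Multiset.map_cons, Multiset.prod_cons, ih, X, monomial_mul, ← Multiset.singleton_add,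
      map_add, Multiset.toFinsupp_singleton, one_mul]

theorem msymm_coe_eq_monoSymm {d : ℕ} (l : d.Partition) :
    ((msymm (Fin d) ℤ l : MvPolynomial (Fin d) ℤ) : MvPowerSeries (Fin d) ℤ)
      = monoSymm (Fin d) ℤ l := by
  classical
  have hparts : ∀ a : Sym (Fin d) d, (Nat.Partition.ofSym a).parts
      = a.1.toFinsupp.support.val.map a.1.toFinsupp := by
    intro a
    rw [Multiset.toFinsupp_support]
    rfl
  ext s
  rw [coeff_coe, msymm, coeff_sum, coeff_monoSymm]
  simp only [prod_X_eq_monomial, coeff_monomial]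
  split_ifs with h
  · have hc : s.toMultiset.card = d := by
      rw [Finsupp.card_toMultiset]
      refine Eq.trans ?_ l.parts_sum
      rw [← h]
      rfl
    have hl : Nat.Partition.ofSym (⟨s.toMultiset, hc⟩ : Sym (Fin d) d) = l := by
      apply Nat.Partition.ext
      refine (hparts _).trans ?_
      rw [← h]
      simp
    rw [Finset.sum_eq_single ⟨⟨s.toMultiset, hc⟩, hl⟩]
    · simp
    · rintro ⟨⟨a, ha⟩, hal⟩ _ hne
      rw [if_neg]
      rintro rfl
      apply hne
      apply Subtype.ext
      apply Subtype.ext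
      simp
    · simp
  · refine Finset.sum_eq_zero fun a _ => if_neg ?_
    rintro rfl
    apply h
    rw [← hparts, a.2]

theorem partExponent_injective {d : ℕ} : Function.Injective (partExponent (d := d)) := by
  intro ν ν' h
  apply Nat.Partition.ext
  ext j
  have key : ∀ (ν : d.Partition) (j : ℕ), (j = 0 ∨ d < j) → ν.parts.count j = 0 := by
    intro ν j hj
    rw [Multiset.count_eq_zero]
    intro hm
    have := ν.parts_pos hm
    have := ν.le_of_mem_parts hm
    omega
  by_cases hj : j = 0 ∨ d < j
  · rw [key _ _ hj, key _ _ hj]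
  · have := DFunLike.congr_fun h (⟨j - 1, by omega⟩ : Fin d)
    simp only [partExponent, Finsupp.equivFunOnFinite_symm_apply_apply] at this
    rwa [show j - 1 + 1 = j by omega] at this

@[to_additive]
theorem prod_parts_eq {d : ℕ} {M : Type*} [CommMonoid M] (ν : d.Partition) (f : ℕ → M) :
    (ν.parts.map f).prod = ∏ i : Fin d, f (i.1 + 1) ^ partExponent ν i := by
  classical
  rw [Finset.prod_multiset_map_count]
  simp only [partExponent, Finsupp.equivFunOnFinite_symm_apply_apply]
  rw [Fin.prod_univ_eq_prod_range (fun i => f (i + 1) ^ ν.parts.count (i + 1)) d,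
    ← Finset.prod_image (s := Finset.range d) (g := (· + 1))
      (f := fun i => f i ^ ν.parts.count i) (fun _ _ _ _ h => Nat.succ_injective h)]
  refine Finset.prod_subset (fun j hj => ?_) fun j _ hj => ?_
  · rw [Multiset.mem_toFinset] at hj
    have h1 := ν.parts_pos hj
    have h2 := ν.le_of_mem_parts hj
    exact Finset.mem_image.mpr ⟨j - 1, Finset.mem_range.mpr (by omega), by omega⟩
  · rw [Multiset.count_eq_zero.mpr (by simpa using hj), pow_zero]

theorem weight_partExponent {d : ℕ} (ν : d.Partition) :
    Finsupp.weight (fun i : Fin d => i.1 + 1) (partExponent ν) = d := by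
  have h := sum_parts_eq ν (fun j => j)
  rw [Multiset.map_id', ν.parts_sum] at h
  rw [Finsupp.weight_apply, Finsupp.sum_fintype _ _ (by simp)]
  exact h.symm

theorem exists_partExponent {d : ℕ} (s : Fin d →₀ ℕ)
    (hs : Finsupp.weight (fun i : Fin d => i.1 + 1) s = d) : ∃ ν : d.Partition, partExponent ν = s := by
  rw [Finsupp.weight_apply, Finsupp.sum_fintype _ _ (by simp)] at hs
  refine ⟨⟨∑ i : Fin d, Multiset.replicate (s i) (i.1 + 1), fun {j} hj => ?_, ?_⟩, ?_⟩
  · obtain ⟨i, _, hi⟩ := Multiset.mem_sum.mp hj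
    rw [Multiset.eq_of_mem_replicate hi]
    omega
  · rw [Multiset.sum_sum]
    simpa using hs
  · ext j
    simp only [partExponent, Finsupp.equivFunOnFinite_symm_apply_apply, Multiset.count_sum',
      Multiset.count_replicate]
    rw [Finset.sum_eq_single j]
    · simp
    · intro i _ hij
      rw [if_neg]
      intro h
      exact hij (Fin.ext (by omega))
    · simp

theorem isHomogeneous_prod_X {d : ℕ} (a : Multiset (Fin d)) :
    (a.map (X : Fin d → MvPolynomial (Fin d) ℤ)).prod.IsHomogeneous a.card := by
  induction a using Multiset.induction_on with
  | empty => simpa using isHomogeneous_one (Fin d) ℤ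
  | cons i a ih =>
    rw [Multiset.map_cons, Multiset.prod_cons, Multiset.card_cons, add_comm]
    exact (isHomogeneous_X ℤ i).mul ih

theorem homogeneousComponent_aeval_esymm {d : ℕ} (p : MvPolynomial (Fin d) ℤ) :
    homogeneousComponent d (aeval (fun i : Fin d => esymm (Fin d) ℤ (i + 1)) p)
      = aeval (fun i : Fin d => esymm (Fin d) ℤ (i + 1))
          (weightedHomogeneousComponent (fun i : Fin d => i.1 + 1) d p) := by
  induction p using MvPolynomial.induction_on' with
  | add p q hp hq => simp only [map_add, hp, hq]
  | monomial s c =>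
    have h1 : (aeval (fun i : Fin d => esymm (Fin d) ℤ (i + 1)) (monomial s c)).IsHomogeneous
        (Finsupp.weight (fun i : Fin d => i.1 + 1) s) := by
      rw [aeval_monomial, Finsupp.weight_apply, Finsupp.sum_fintype _ _ (by simp),
        Finsupp.prod_fintype _ _ (by simp)]
      rw [← zero_add (∑ i, _)]
      refine IsHomogeneous.mul (isHomogeneous_C _ c) (IsHomogeneous.prod _ _ _ fun i _ => ?_)
      rw [smul_eq_mul, mul_comm]
      exact (show (esymm (Fin d) ℤ (i.1 + 1)).IsHomogeneous (i.1 + 1) from IsHomogeneous.sum _ _ _ fun t ht => (by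
        simpa [(Finset.mem_powersetCard.mp ht).2] using isHomogeneous_prod_X t.val)).pow (s i)
    rw [homogeneousComponent_of_mem h1,
      weightedHomogeneousComponent_of_mem (isWeightedHomogeneous_monomial _ s c rfl)]
    split_ifs <;> simp

theorem msymm_eq_sum {d : ℕ} (l : d.Partition) :
    msymm (Fin d) ℤ l = ∑ ν : d.Partition, monoToElem l ν • esymmPart (Fin d) ℤ ν := by
  classical
  set p := (esymmAlgEquiv (Fin d) ℤ (Fintype.card_fin d)).symm
    ⟨msymm (Fin d) ℤ l, msymm_isSymmetric (Fin d) ℤ l⟩ with hp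
  have hpm : aeval (fun i : Fin d => esymm (Fin d) ℤ (i + 1)) p = msymm (Fin d) ℤ l := by
    have := congrArg Subtype.val ((esymmAlgEquiv (Fin d) ℤ (Fintype.card_fin d)).apply_symm_apply
      ⟨msymm (Fin d) ℤ l, msymm_isSymmetric (Fin d) ℤ l⟩)
    rw [← hp, esymmAlgEquiv_apply] at this
    exact (esymmAlgHom_apply ..).symm.trans this
  have hhom : (msymm (Fin d) ℤ l).IsHomogeneous d := by
    refine IsHomogeneous.sum _ _ _ fun a _ => ?_
    have := isHomogeneous_prod_X a.1.1
    rwa [a.1.2] at this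
  have hcomp : weightedHomogeneousComponent (fun i : Fin d => i.1 + 1) d p
      = ∑ ν : d.Partition, monomial (partExponent ν) (monoToElem l ν) := by
    ext t
    rw [coeff_weightedHomogeneousComponent, coeff_sum]
    simp only [coeff_monomial]
    split_ifs with ht
    · obtain ⟨ν, rfl⟩ := exists_partExponent t ht
      rw [Finset.sum_eq_single ν]
      · simp [monoToElem, hp]
      · intro ν' _ hne
        exact if_neg fun h => hne (partExponent_injective h)
      · simp
    · refine (Finset.sum_eq_zero fun ν _ => if_neg ?_).symm
      rintro rfl
      exact ht (weight_partExponent ν)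
  rw [← homogeneousComponent_eq_self hhom, ← hpm, homogeneousComponent_aeval_esymm, hcomp,
    map_sum]
  refine Finset.sum_congr rfl fun ν _ => ?_
  rw [aeval_monomial, Finsupp.prod_fintype _ _ (by simp), esymmPart, prod_parts_eq]
  simp [Algebra.smul_def]

theorem killCompl_elemSymm {σ τ : Type*} (e : σ ↪ τ) (k : ℕ) :
    MvPowerSeries.killCompl e (elemSymm τ ℤ k) = elemSymm σ ℤ k := by
  classical
  ext s
  have h1 : (s.embDomain e).degree = s.degree := by
    rw [Finsupp.embDomain_eq_mapDomain, Finsupp.degree_mapDomain]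
  have h2 : (∀ i, s.embDomain e i ≤ 1) ↔ ∀ i, s i ≤ 1 := by
    refine ⟨fun h i => by simpa using h (e i), fun h i => ?_⟩
    by_cases hi : i ∈ Set.range e
    · obtain ⟨j, rfl⟩ := hi
      simpa using h j
    · rw [Finsupp.embDomain_of_notMem_range _ _ _ hi]; exact zero_le_one
  rw [MvPowerSeries.coeff_killCompl, coeff_elemSymm, coeff_elemSymm]
  simp only [h1, h2]

theorem coeff_elemSymmPart_eq_zero {σ : Type*} {d : ℕ} (ν : d.Partition) (s : σ →₀ ℕ)
    (hs : s.degree ≠ d) : MvPowerSeries.coeff s (elemSymmPart σ ℤ ν) = 0 := by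
  classical
  have key : ∀ (m : Multiset ℕ) (s : σ →₀ ℕ), s.degree ≠ m.sum →
      MvPowerSeries.coeff s (m.map (elemSymm σ ℤ)).prod = 0 := by
    intro m
    induction m using Multiset.induction_on with
    | empty =>
      intro s hs
      rw [Multiset.map_zero, Multiset.prod_zero, MvPowerSeries.coeff_one, if_neg]
      rintro rfl
      simp at hs
    | cons k m ih =>
      intro s hs
      rw [Multiset.map_cons, Multiset.prod_cons, MvPowerSeries.coeff_mul]
      refine Finset.sum_eq_zero fun x hx => ?_
      have hx := Finset.HasAntidiagonal.mem_antidiagonal.mp hx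
      by_cases h : x.1.degree = k
      · rw [ih, mul_zero]
        intro h'
        apply hs
        rw [← hx, map_add, h, h', Multiset.sum_cons]
      · rw [coeff_elemSymm, if_neg (fun h' => h h'.1), zero_mul]
  exact key _ s (by rwa [ν.parts_sum])

/-- `m_λ = ∑_{ν ⊢ d} N_{λ,ν} e_ν` in infinitely many variables. -/
theorem monoSymm_eq_sum (σ : Type*) [Infinite σ] {d : ℕ} (l : d.Partition) :
    monoSymm σ ℤ l = ∑ ν : d.Partition, monoToElem l ν • elemSymmPart σ ℤ ν := by
  classical
  ext s
  by_cases hs : s.degree = d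
  · have hcard : s.support.card ≤ d := by
      rw [← hs, Finsupp.degree, Finset.card_eq_sum_ones]
      exact Finset.sum_le_sum fun i hi => Nat.one_le_iff_ne_zero.mpr (Finsupp.mem_support_iff.mp hi)
    obtain ⟨T, hT, hTd⟩ := Infinite.exists_superset_card_eq s.support d hcard
    let e : Fin d ↪ σ := (T.equivFinOfCardEq hTd).symm.toEmbedding.trans (Function.Embedding.subtype _)
    have hrange : (s.support : Set σ) ⊆ Set.range e := by
      intro i hi
      exact ⟨T.equivFinOfCardEq hTd ⟨i, hT hi⟩, by simp [e]⟩
    obtain ⟨t, rfl⟩ : ∃ t : Fin d →₀ ℕ, t.embDomain e = s :=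
      ⟨s.comapDomain e e.injective.injOn, Finsupp.embDomain_comapDomain hrange⟩
    have hmono : MvPowerSeries.coeff (t.embDomain e) (monoSymm σ ℤ l)
        = MvPowerSeries.coeff t (monoSymm (Fin d) ℤ l) := by
      have : (t.embDomain e).support.val.map (t.embDomain e) = t.support.val.map t := by
        rw [Finsupp.support_embDomain, Finset.map_val, Multiset.map_map]
        exact Multiset.map_congr rfl fun i _ => by simp
      rw [coeff_monoSymm, coeff_monoSymm]
      simp only [this]
    have helem : ∀ ν : d.Partition, MvPowerSeries.killCompl e (elemSymmPart σ ℤ ν)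
        = ((esymmPart (Fin d) ℤ ν : MvPolynomial (Fin d) ℤ) : MvPowerSeries (Fin d) ℤ) := by
      intro ν
      rw [elemSymmPart, esymmPart, map_multiset_prod, Multiset.map_map,
        ← coeToMvPowerSeries.ringHom_apply, map_multiset_prod, Multiset.map_map]
      congr 1
      refine Multiset.map_congr rfl fun k _ => ?_
      simp [killCompl_elemSymm, esymm_coe_eq_elemSymm]
    rw [hmono, ← MvPowerSeries.coeff_killCompl, map_sum, ← msymm_coe_eq_monoSymm, msymm_eq_sum,
      ← coeToMvPowerSeries.ringHom_apply, map_sum]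
    congr 1
    refine Finset.sum_congr rfl fun ν _ => ?_
    rw [map_zsmul, map_zsmul, helem]
    rfl
  · rw [map_sum, coeff_monoSymm, if_neg, Finset.sum_eq_zero]
    · intro ν _
      rw [map_zsmul, coeff_elemSymmPart_eq_zero ν s hs, smul_zero]
    · intro h
      apply hs
      refine Eq.trans ?_ l.parts_sum
      rw [← h]
      rfl

end Expansion

/-! ## Chromatic quasisymmetric functions -/

section Chromatic

variable {n : ℕ}

/-- Proper multi-colorings of `G` of type `μ`, with positive integers as colors. -/
def IsProperMultiColoring (G : SimpleGraph (Fin n)) (μ : Fin n → ℕ) (κ : Fin n → Finset ℕ+) :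
    Prop :=
  (∀ i, (κ i).card = μ i) ∧ ∀ i j, G.Adj i j → Disjoint (κ i) (κ j)

/-- The exponent vector of `x^κ`: the color `k` is used by `#{i | k ∈ κ i}` vertices. -/
noncomputable def coloringExponent (κ : Fin n → Finset ℕ+) : ℕ+ →₀ ℕ :=
  ∑ i, ∑ k ∈ κ i, Finsupp.single k 1

open Classical in
/-- The number of pairs `((i, r), (j, s))` with `{i, j}` an edge, `i < j`, `r ∈ κ i`, `s ∈ κ j`
and `r < s`. -/
noncomputable def coloringAsc (G : SimpleGraph (Fin n)) (κ : Fin n → Finset ℕ+) : ℕ :=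
  ∑ i, ∑ j, if G.Adj i j ∧ i < j then {p ∈ κ i ×ˢ κ j | p.1 < p.2}.card else 0

open Classical in
/-- The finitely many proper multi-colorings `κ` of type `μ` with `x^κ = x^s`. All colors of such a `κ`
lie in the support of `s`, so the ambient finite set is no restriction; see
`mem_coloringsWithExponent`. -/
noncomputable def coloringsWithExponent (G : SimpleGraph (Fin n)) (μ : Fin n → ℕ) (s : ℕ+ →₀ ℕ) :
    Finset (Fin n → Finset ℕ+) :=
  {κ ∈ Fintype.piFinset fun _ => s.support.powerset |
    IsProperMultiColoring G μ κ ∧ coloringExponent κ = s}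

theorem mem_coloringsWithExponent (G : SimpleGraph (Fin n)) (μ : Fin n → ℕ) (s : ℕ+ →₀ ℕ)
    (κ : Fin n → Finset ℕ+) :
    κ ∈ coloringsWithExponent G μ s ↔ IsProperMultiColoring G μ κ ∧ coloringExponent κ = s := by
  classical
  rw [coloringsWithExponent, Finset.mem_filter, and_iff_right_iff_imp]
  rintro ⟨-, rfl⟩
  refine Fintype.mem_piFinset.mpr fun i => Finset.mem_powerset.mpr fun k hk => ?_
  rw [Finsupp.mem_support_iff, coloringExponent, Finsupp.finsetSum_apply, ← Nat.pos_iff_ne_zero]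
  refine lt_of_lt_of_le ?_ (Finset.single_le_sum (fun _ _ => Nat.zero_le _) (Finset.mem_univ i))
  rw [Finsupp.finsetSum_apply]
  exact lt_of_lt_of_le (by simp)
    (Finset.single_le_sum (f := fun j => Finsupp.single j 1 k) (fun _ _ => Nat.zero_le _) hk)

/-- The (multi-)chromatic quasisymmetric function `X_G(x, q; μ) = ∑_κ q^{asc(κ)} x^κ` over all proper
multi-colorings `κ` of type `μ`, a power series in `x_1, x_2, …` with coefficients in `ℚ[q]`. -/
noncomputable def chromaticQSym (G : SimpleGraph (Fin n)) (μ : Fin n → ℕ) :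
    MvPowerSeries ℕ+ (Polynomial ℚ) :=
  fun s => ∑ κ ∈ coloringsWithExponent G μ s, Polynomial.X ^ coloringAsc G κ

end Chromatic

/-! ## Heaps -/

section Heaps

variable {n : ℕ}

/-- The blocks `v_{a,i}`, `a ∈ {1, …, n}`, `1 ≤ i ≤ μ_a`. -/
abbrev Block (μ : Fin n → ℕ) : Type := Σ a : Fin n, Fin (μ a)

/-- Adjacency in the graph `P^μ`: distinct blocks in the same column or in incomparable columns. -/
def blockAdj (P : NatUnitIntervalOrder n) (μ : Fin n → ℕ) (p q : Block μ) : Prop :=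
  p ≠ q ∧ (p.1 = q.1 ∨ P.inc.Adj p.1 q.1)

/-- A heap of `P` of type `μ`: an acyclic orientation of `P^μ` in which the edge between `v_{a,i}` and
`v_{a,j}`, `i < j`, points to `v_{a,i}`. Here `arrow p q` means that the edge `{p, q}` points from
`p` to `q`. -/
@[ext]
structure Heap (P : NatUnitIntervalOrder n) (μ : Fin n → ℕ) where
  arrow : Block μ → Block μ → Prop
  adj_iff : ∀ p q, blockAdj P μ p q ↔ arrow p q ∨ arrow q p
  asymm : ∀ p q, arrow p q → ¬ arrow q p
  acyclic : ∀ p, ¬ Relation.TransGen arrow p p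
  column : ∀ (a : Fin n) (i j : Fin (μ a)), i < j → arrow ⟨a, j⟩ ⟨a, i⟩

namespace Heap

variable {P : NatUnitIntervalOrder n} {μ : Fin n → ℕ}

instance : Finite (Heap P μ) :=
  Finite.of_injective Heap.arrow fun _ _ => Heap.ext

noncomputable instance : Fintype (Heap P μ) := Fintype.ofFinite _

/-- A sink is a block without outgoing edge. -/
def IsSink (H : Heap P μ) (p : Block μ) : Prop := ∀ q, ¬ H.arrow p q

open Classical in
/-- The number of sinks. -/
noncomputable def numSinks (H : Heap P μ) : ℕ := {p | H.IsSink p}.toFinset.card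

open Classical in
/-- The number of ascent edges: edges from `v_{b,j}` to `v_{a,i}` with `a > b`. -/
noncomputable def asc (H : Heap P μ) : ℕ :=
  {e : Block μ × Block μ | H.arrow e.1 e.2 ∧ e.1.1 < e.2.1}.toFinset.card

/-- `w ∈ W(H)`: the blocks can be listed as `f 1, …, f d` such that every edge points to the block that
is listed first and `w_k` is the column of `f k`. -/
def IsWord (H : Heap P μ) (w : List (Fin n)) : Prop :=
  ∃ f : Fin w.length ≃ Block μ,
    (∀ j k, H.arrow (f k) (f j) → j < k) ∧ ∀ k, w.get k = (f k).1

end Heap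

/-- `w` has no `P`-descents, i.e. there is no `i` with `w_i >_P w_{i+1}`. -/
def NoPDescents (P : NatUnitIntervalOrder n) (w : List (Fin n)) : Prop :=
  w.IsChain fun a b => ¬ P.lt b a

namespace Heap

variable {P : NatUnitIntervalOrder n} {μ : Fin n → ℕ}

theorem lt_or_lt_of_not_arrow (H : Heap P μ) {p q : Block μ} (hne : p ≠ q) (h : ¬ H.arrow p q)
    (h' : ¬ H.arrow q p) : P.lt p.1 q.1 ∨ P.lt q.1 p.1 := by
  have := (H.adj_iff p q).not.mpr (by tauto)
  simp only [blockAdj, NatUnitIntervalOrder.inc] at this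
  tauto

/-- A listing of the blocks in `S` in which every edge points to the block that is listed first and
the columns of consecutive blocks form no `P`-descent. -/
def IsListing (H : Heap P μ) (S : Finset (Block μ)) (L : List (Block μ)) : Prop :=
  L.Nodup ∧ (∀ p, p ∈ L ↔ p ∈ S) ∧ L.Pairwise (fun p q => ¬ H.arrow p q) ∧
    L.IsChain fun p q => ¬ P.lt q.1 p.1

theorem exists_sink (H : Heap P μ) (S : Finset (Block μ)) (hS : S.Nonempty) :
    ∃ p ∈ S, ∀ q ∈ S, ¬ H.arrow p q := by
  have : IsStrictOrder (Block μ) (Relation.TransGen H.arrow) :=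
    { irrefl := H.acyclic, trans := fun _ _ _ => Relation.TransGen.trans }
  have hwf : WellFounded (Function.swap (Relation.TransGen H.arrow)) :=
    Finite.wellFounded_of_trans_of_irrefl _
  obtain ⟨p, hp, h⟩ := hwf.has_min (S : Set (Block μ)) hS
  exact ⟨p, hp, fun q hq hpq => h q hq (Relation.TransGen.single hpq)⟩

theorem exists_listing (H : Heap P μ) (S : Finset (Block μ)) : ∃ L, H.IsListing S L := by
  classical
  induction S using Finset.strongInduction with
  | H S ih =>
    rcases S.eq_empty_or_nonempty with rfl | hS
    · exact ⟨[], by simp [IsListing]⟩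
    · obtain ⟨p₀, hp₀, hs₀⟩ := H.exists_sink S hS
      obtain ⟨p, hp, hmin⟩ := Finset.exists_min_image
        {p ∈ S | ∀ q ∈ S, ¬ H.arrow p q} (fun p => p.1) ⟨p₀, by simp [hp₀]; simpa using hs₀⟩
      rw [Finset.mem_filter] at hp
      obtain ⟨L, hnd, hmem, hpw, hch⟩ := ih (S.erase p) (Finset.erase_ssubset hp.1)
      refine ⟨p :: L, List.nodup_cons.mpr ⟨by simp [hmem], hnd⟩, fun q => ?_,
        List.pairwise_cons.mpr ⟨fun q hq => hp.2 q ?_, hpw⟩, ?_⟩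
      · by_cases h : q = p
        · simp [h, hp.1]
        · simp [hmem, h]
      · exact Finset.mem_of_mem_erase ((hmem q).mp hq)
      · cases L with
        | nil => simp
        | cons q L =>
          refine List.isChain_cons_cons.mpr ⟨fun hlt => ?_, hch⟩
          have hq := (hmem q).mp (by simp)
          have hqs : ∀ r ∈ S, ¬ H.arrow q r := by
            intro r hr har
            by_cases hrp : r = p
            · subst hrp
              have hadj := (H.adj_iff q r).mpr (Or.inl har)
              rcases hadj.2 with h | h
              · rw [h] at hlt; exact P.lt_irrefl _ hlt
              · exact h.2.1 hlt
            · have := (hmem r).mpr (Finset.mem_erase.mpr ⟨hrp, hr⟩)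
              rcases List.mem_cons.mp this with rfl | h
              · exact H.asymm _ _ har har
              · exact (List.pairwise_cons.mp hpw).1 r h har
          have := hmin q (Finset.mem_filter.mpr ⟨Finset.mem_of_mem_erase hq, hqs⟩)
          exact absurd (NatUnitIntervalOrder.lt_imp_lt hlt) (not_lt.mpr this)

theorem listing_head (H : Heap P μ) {p : Block μ} {M : List (Block μ)} :
    ∀ q, (q :: M).Pairwise (fun p q => ¬ H.arrow p q) →
      (q :: M).IsChain (fun p q => ¬ P.lt q.1 p.1) → P.lt p.1 q.1 →
      (∀ r ∈ M, ¬ H.arrow p r) → p ∉ M := by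
  induction M with
  | nil => simp
  | cons r M ih =>
    intro q hpw hch hlt hs hp
    rw [List.isChain_cons_cons] at hch
    rw [List.pairwise_cons] at hpw
    by_cases hr : p = r
    · subst hr; exact hch.1 hlt
    · have hpM : p ∈ M := (List.mem_cons.mp hp).resolve_left hr
      rcases H.lt_or_lt_of_not_arrow hr (hs r (by simp))
        ((List.pairwise_cons.mp hpw.2).1 p hpM) with h | h
      · exact ih r hpw.2 hch.2 h (fun s hs' => hs s (by simp [hs'])) hpM
      · exact hch.1 (NatUnitIntervalOrder.lt_trans h hlt)

theorem listing_unique (H : Heap P μ) (S : Finset (Block μ)) (L L' : List (Block μ))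
    (h : H.IsListing S L) (h' : H.IsListing S L') : L = L' := by
  classical
  induction L generalizing S L' with
  | nil =>
    cases L' with
    | nil => rfl
    | cons q M => exact absurd ((h.2.1 q).mpr ((h'.2.1 q).mp (by simp))) (by simp)
  | cons p L ih =>
    cases L' with
    | nil => exact absurd ((h'.2.1 p).mpr ((h.2.1 p).mp (by simp))) (by simp)
    | cons q M =>
      have hsink : ∀ {T : Finset (Block μ)} {a : Block μ} {K : List (Block μ)},
          H.IsListing T (a :: K) → ∀ r ∈ T, ¬ H.arrow a r := by
        intro T a K hK r hr har
        rcases List.mem_cons.mp ((hK.2.1 r).mpr hr) with rfl | hr'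
        · exact H.asymm _ _ har har
        · exact (List.pairwise_cons.mp hK.2.2.1).1 r hr' har
      have hpS := (h.2.1 p).mp (by simp)
      have hqS := (h'.2.1 q).mp (by simp)
      have hpq : p = q := by
        by_contra hne
        rcases H.lt_or_lt_of_not_arrow hne (hsink h q hqS) (hsink h' p hpS) with hlt | hlt
        · refine H.listing_head q h'.2.2.1 h'.2.2.2 hlt
            (fun r hr => hsink h r ((h'.2.1 r).mp (by simp [hr])))
            ((List.mem_cons.mp ((h'.2.1 p).mpr hpS)).resolve_left hne)
        · refine H.listing_head p h.2.2.1 h.2.2.2 hlt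
            (fun r hr => hsink h' r ((h.2.1 r).mp (by simp [hr])))
            ((List.mem_cons.mp ((h.2.1 q).mpr hqS)).resolve_left (Ne.symm hne))
      subst hpq
      have htail : ∀ {K : List (Block μ)}, H.IsListing S (p :: K) →
          H.IsListing (S.erase p) K := by
        intro K hK
        obtain ⟨hnd, hmem, hpw, hch⟩ := hK
        rw [List.nodup_cons] at hnd
        refine ⟨hnd.2, fun r => ?_, (List.pairwise_cons.mp hpw).2, hch.tail⟩
        rw [Finset.mem_erase, ← hmem r, List.mem_cons]
        constructor
        · intro hr
          exact ⟨fun e => hnd.1 (e ▸ hr), Or.inr hr⟩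
        · rintro ⟨h1, h2⟩
          exact h2.resolve_left h1
      rw [ih _ _ (htail h) (htail h')]

theorem isWord_iff (H : Heap P μ) (w : List (Fin n)) :
    H.IsWord w ∧ NoPDescents P w ↔ ∃ L, H.IsListing Finset.univ L ∧ L.map Sigma.fst = w := by
  classical
  constructor
  · rintro ⟨⟨f, hf, hw⟩, hd⟩
    have hmap : (List.ofFn f).map Sigma.fst = w := by
      rw [List.map_ofFn]
      conv_rhs => rw [← List.ofFn_get w]
      congr 1
      funext k
      exact (hw k).symm
    refine ⟨List.ofFn f, ⟨List.nodup_ofFn.mpr f.injective, fun p => ?_, ?_, ?_⟩, hmap⟩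
    · simpa [List.mem_ofFn] using f.surjective p
    · rw [List.pairwise_ofFn]
      intro i j hij har
      exact absurd (hf j i har) (not_lt.mpr hij.le)
    · rw [← hmap, NoPDescents, List.isChain_map] at hd
      exact hd
  · rintro ⟨L, ⟨hnd, hmem, hpw, hch⟩, rfl⟩
    refine ⟨⟨(finCongr (List.length_map _)).trans
      (hnd.getEquivOfForallMemList L fun p => (hmem p).mpr (Finset.mem_univ p)),
      fun j k har => ?_, fun k => by simp⟩, ?_⟩
    · by_contra hle
      rcases (not_lt.mp hle).eq_or_lt with h | h
      · subst h; exact H.asymm _ _ har har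
      · exact List.pairwise_iff_get.mp hpw (finCongr (List.length_map _) k)
          (finCongr (List.length_map _) j) h har
    · simpa [NoPDescents, List.isChain_map] using hch

theorem existsUnique_word (H : Heap P μ) : ∃! w, H.IsWord w ∧ NoPDescents P w := by
  obtain ⟨L, hL⟩ := H.exists_listing Finset.univ
  refine ⟨L.map Sigma.fst, (H.isWord_iff _).mpr ⟨L, hL, rfl⟩, fun w hw => ?_⟩
  obtain ⟨L', hL', rfl⟩ := (H.isWord_iff w).mp hw
  rw [H.listing_unique _ _ _ hL' hL]

/-- The word `w_H`: the unique word in `W(H)` without `P`-descents. -/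
noncomputable def word (H : Heap P μ) : List (Fin n) := H.existsUnique_word.choose

end Heap

end Heaps

/-! ## Noncommutative `P`-symmetric functions -/

section Noncommutative

variable {n : ℕ}

/-- The monomial `u_w = u_{w_1} ⋯ u_{w_d}` in the free algebra `ℤ⟨u_1, …, u_n⟩`. -/
noncomputable def wordMonomial (w : List (Fin n)) : FreeAlgebra ℤ (Fin n) :=
  (w.map (FreeAlgebra.ι ℤ)).prod

namespace NatUnitIntervalOrder

variable (P : NatUnitIntervalOrder n)

/-- The two-sided ideal `I_P`. -/
noncomputable def ideal : TwoSidedIdeal (FreeAlgebra ℤ (Fin n)) :=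
  TwoSidedIdeal.span
    ({z | ∃ a c, P.lt a c ∧ z = wordMonomial [a, c] - wordMonomial [c, a]} ∪
     {z | ∃ a b c, a < b ∧ b < c ∧ ¬ P.lt a b ∧ ¬ P.lt b c ∧ P.lt a c ∧
        z = wordMonomial [a, c, b] - wordMonomial [b, a, c]})

open Classical in
/-- The noncommutative `P`-elementary symmetric function: the sum of `u_{i_1} ⋯ u_{i_k}` over all
`i_1 >_P ⋯ >_P i_k`. -/
noncomputable def elem (k : ℕ) : FreeAlgebra ℤ (Fin n) :=
  ∑ i : Fin k → Fin n with (List.ofFn i).IsChain (fun a b => P.lt b a), wordMonomial (List.ofFn i)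

/-- `e_λ(u) = e_{λ_1}(u) e_{λ_2}(u) ⋯` with `λ_1 ≥ λ_2 ≥ ⋯`. -/
noncomputable def elemPart {d : ℕ} (l : d.Partition) : FreeAlgebra ℤ (Fin n) :=
  ((l.parts.sort (· ≥ ·)).map P.elem).prod

/-- The noncommutative `P`-monomial symmetric function `m_λ(u) = ∑_ν N_{λ,ν} e_ν(u)`. -/
noncomputable def monomial {d : ℕ} (l : d.Partition) : FreeAlgebra ℤ (Fin n) :=
  ∑ ν : d.Partition, monoToElem l ν • P.elemPart ν

end NatUnitIntervalOrder

end Noncommutative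

/-! ## Commuting generating functions -/

section CommutingSeries

variable {B : Type*} [Ring B] {u : ℕ → B} {p : ℕ → ℕ} {x y : B} {E F : ℕ → B}

theorem commute_initial (hE₀ : E 0 = 1) (hE : ∀ r, E (r + 1) = E r + x * (u r * E (p r)))
    (hx : ∀ z, Commute x z) (hp : ∀ c, p c ≤ c) {z : B} (r : ℕ)
    (hz : ∀ i < r, Commute z (u i)) : Commute z (E r) := by
  induction r using Nat.strong_induction_on with
  | _ r ih =>
    cases r with
    | zero => rw [hE₀]; exact Commute.one_right z
    | succ r =>
      rw [hE]
      refine (ih r (by omega) fun i hi => hz i (by omega)).add_right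
        ((hx z).symm.mul_right ((hz r (by omega)).mul_right ?_))
      have := hp r
      exact ih (p r) (by omega) fun i hi => hz i (by omega)

theorem initial_eq_add_sum (hE : ∀ r, E (r + 1) = E r + x * (u r * E (p r))) {s r : ℕ}
    (h : s ≤ r) : E r = E s + ∑ i ∈ Finset.Ico s r, x * (u i * E (p i)) := by
  induction r, h using Nat.le_induction with
  | base => simp
  | succ r h ih => rw [hE, Finset.sum_Ico_succ_top h, ← add_assoc, ← ih]

/-- `x u_j E_{p j} F_r + y E_r u_j F_{p j}` is symmetric under exchanging `(x, E)` and `(y, F)`, if the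
same holds for all smaller `j` and the initial generating functions commute. -/
theorem exchange_initial
    (hp : ∀ c, p c ≤ c) (hmono : Monotone p)
    (hcomm : ∀ a c, a < p c → Commute (u a) (u c))
    (hcub : ∀ a b c, a < b → b < c → p b ≤ a → p c ≤ b → a < p c →
      u a * u c * u b = u b * u a * u c)
    (hx : ∀ z, Commute x z) (hy : ∀ z, Commute y z)
    (hE₀ : E 0 = 1) (hE : ∀ r, E (r + 1) = E r + x * (u r * E (p r)))
    (hF₀ : F 0 = 1) (hF : ∀ r, F (r + 1) = F r + y * (u r * F (p r))) (j : ℕ)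
    (hC : ∀ i ≤ j, E i * F i = F i * E i)
    (hA : ∀ k < j, ∀ r, p k ≤ r → r ≤ k →
      x * (u k * (E (p k) * F r)) + y * (E r * (u k * F (p k)))
        = y * (u k * (F (p k) * E r)) + x * (F r * (u k * E (p k))))
    (r : ℕ) (hr : p j ≤ r) (hrj : r ≤ j) :
    x * (u j * (E (p j) * F r)) + y * (E r * (u j * F (p j)))
      = y * (u j * (F (p j) * E r)) + x * (F r * (u j * E (p j))) := by
  have hcE : ∀ c s, s ≤ p c → E s * u c = u c * E s := fun c s hs =>
    (commute_initial hE₀ hE hx hp s fun i hi => (hcomm i c (by omega)).symm).eq.symm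
  have hcF : ∀ c s, s ≤ p c → F s * u c = u c * F s := fun c s hs =>
    (commute_initial hF₀ hF hy hp s fun i hi => (hcomm i c (by omega)).symm).eq.symm
  have hT : ∀ i, p j ≤ i → i < r →
      u j * (E (p j) * (u i * F (p i))) + u i * (E (p i) * (u j * F (p j)))
        = u j * (F (p j) * (u i * E (p i))) + u i * (F (p i) * (u j * E (p j))) := by
    intro i hi hir
    have hpi : p i ≤ p j := hmono (by omega)
    have hk : ∀ k ∈ Finset.Ico (p i) (p j),
        u j * (x * (u k * E (p k)) * (u i * F (p i)))
            + u i * (E (p i) * (u j * (y * (u k * F (p k)))))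
          = u j * (y * (u k * F (p k)) * (u i * E (p i)))
            + u i * (F (p i) * (u j * (x * (u k * E (p k))))) := by
      intro k hk
      rw [Finset.mem_Ico] at hk
      have hpj := hp j
      have hpk : p k ≤ p i := hmono (by omega)
      have h3 : u j * (u k * u i) = u i * (u j * u k) := by
        rw [← mul_assoc, ← (hcomm k j hk.2).eq, hcub k i j (by omega) (by omega) hk.1 hi hk.2,
          mul_assoc, (hcomm k j hk.2).eq]
      have e1 : u j * (x * (u k * E (p k)) * (u i * F (p i)))
          = u i * (u j * (x * (u k * (E (p k) * F (p i))))) := by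
        calc _ = x * ((u j * (u k * (E (p k) * u i))) * F (p i)) := by
              rw [mul_assoc, ← mul_assoc (u j), ← (hx (u j)).eq]; simp only [mul_assoc]
          _ = x * ((u j * (u k * u i)) * (E (p k) * F (p i))) := by
              rw [hcE i _ hpk]; simp only [mul_assoc]
          _ = _ := by
              rw [h3, ← (hx (u j)).left_comm, ← (hx (u i)).left_comm]; simp only [mul_assoc]
      have e1' : u j * (y * (u k * F (p k)) * (u i * E (p i)))
          = u i * (u j * (y * (u k * (F (p k) * E (p i))))) := by
        calc _ = y * ((u j * (u k * (F (p k) * u i))) * E (p i)) := by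
              rw [mul_assoc, ← mul_assoc (u j), ← (hy (u j)).eq]; simp only [mul_assoc]
          _ = y * ((u j * (u k * u i)) * (F (p k) * E (p i))) := by
              rw [hcF i _ hpk]; simp only [mul_assoc]
          _ = _ := by
              rw [h3, ← (hy (u j)).left_comm, ← (hy (u i)).left_comm]; simp only [mul_assoc]
      have e2 : u i * (E (p i) * (u j * (y * (u k * F (p k)))))
          = u i * (u j * (y * (E (p i) * (u k * F (p k))))) := by
        rw [← mul_assoc (E _), hcE j _ hpi, mul_assoc, ← mul_assoc (E _), ← (hy _).eq, mul_assoc]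
      have e2' : u i * (F (p i) * (u j * (x * (u k * E (p k)))))
          = u i * (u j * (x * (F (p i) * (u k * E (p k))))) := by
        rw [← mul_assoc (F _), hcF j _ hpi, mul_assoc, ← mul_assoc (F _), ← (hx _).eq, mul_assoc]
      rw [e1, e1', e2, e2', ← mul_add, ← mul_add, ← mul_add, ← mul_add,
        hA k (by omega) (p i) hpk hk.1]
    have hCi := hC (p i) (by have := hp j; omega)
    have h1 : u j * (E (p i) * (u i * F (p i))) = u j * (F (p i) * (u i * E (p i))) := by
      rw [← mul_assoc (E _), ← mul_assoc (F _), hcE i _ le_rfl, hcF i _ le_rfl, mul_assoc, mul_assoc,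
        hCi]
    have h2 : u i * (E (p i) * (u j * F (p i))) = u i * (F (p i) * (u j * E (p i))) := by
      rw [← mul_assoc (E _), ← mul_assoc (F _), hcE j _ hpi, hcF j _ hpi, mul_assoc, mul_assoc,
        hCi]
    have hsum := Finset.sum_congr (rfl : Finset.Ico (p i) (p j) = _) hk
    rw [Finset.sum_add_distrib, Finset.sum_add_distrib] at hsum
    rw [initial_eq_add_sum hE hpi, initial_eq_add_sum hF hpi]
    simp only [add_mul, mul_add, Finset.sum_mul, Finset.mul_sum]
    simp only [mul_assoc] at hsum h1 h2 ⊢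
    rw [h1, h2]
    refine sub_eq_zero.mp (Eq.trans ?_ (sub_eq_zero.mpr hsum))
    abel
  have hCj := hC (p j) (hp j)
  have hsum := Finset.sum_congr (rfl : Finset.Ico (p j) r = _)
    (fun i hi => congrArg (fun z => x * (y * z))
      (hT i (Finset.mem_Ico.mp hi).1 (Finset.mem_Ico.mp hi).2))
  simp only [mul_add, Finset.sum_add_distrib] at hsum
  have h1 : E (p j) * (u j * F (p j)) = u j * (F (p j) * E (p j)) := by
    rw [← mul_assoc, hcE j _ le_rfl, mul_assoc, hCj]
  have h2 : F (p j) * (u j * E (p j)) = u j * (F (p j) * E (p j)) := by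
    rw [← mul_assoc, hcF j _ le_rfl, mul_assoc]
  rw [initial_eq_add_sum hE hr, initial_eq_add_sum hF hr]
  simp only [add_mul, mul_add, Finset.sum_mul, Finset.mul_sum, mul_assoc]
  rw [h1, h2, hCj]
  have hl : ∀ a b c : B, a * (b * (y * c)) = y * (a * (b * c)) := fun a b c => by
    rw [← (hy b).left_comm, ← (hy a).left_comm]
  have hl' : ∀ a b c : B, a * (b * (x * c)) = x * (a * (b * c)) := fun a b c => by
    rw [← (hx b).left_comm, ← (hx a).left_comm]
  simp only [hl, hl']
  simp only [← (hx y).left_comm] at hsum ⊢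
  refine sub_eq_zero.mp (Eq.trans ?_ (sub_eq_zero.mpr hsum))
  abel

/-- Generating functions of chains in a natural unit interval order commute. -/
theorem initial_mul_comm
    (hp : ∀ c, p c ≤ c) (hmono : Monotone p)
    (hcomm : ∀ a c, a < p c → Commute (u a) (u c))
    (hcub : ∀ a b c, a < b → b < c → p b ≤ a → p c ≤ b → a < p c →
      u a * u c * u b = u b * u a * u c)
    (hx : ∀ z, Commute x z) (hy : ∀ z, Commute y z)
    (hE₀ : E 0 = 1) (hE : ∀ r, E (r + 1) = E r + x * (u r * E (p r)))
    (hF₀ : F 0 = 1) (hF : ∀ r, F (r + 1) = F r + y * (u r * F (p r))) (j : ℕ) :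
    E j * F j = F j * E j ∧ ∀ r, p j ≤ r → r ≤ j →
      x * (u j * (E (p j) * F r)) + y * (E r * (u j * F (p j)))
        = y * (u j * (F (p j) * E r)) + x * (F r * (u j * E (p j))) := by
  induction j using Nat.strong_induction_on with
  | _ j ih =>
    have hC : E j * F j = F j * E j := by
      cases j with
      | zero => rw [hE₀, hF₀]
      | succ j =>
        obtain ⟨hj, hA⟩ := ih j (by omega)
        have hcE : E (p j) * u j = u j * E (p j) :=
          (commute_initial hE₀ hE hx hp _ fun i hi => (hcomm i j (by omega)).symm).eq.symm
        have hcF : F (p j) * u j = u j * F (p j) :=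
          (commute_initial hF₀ hF hy hp _ fun i hi => (hcomm i j (by omega)).symm).eq.symm
        have hCp := (ih (p j) (by have := hp j; omega)).1
        have h1 : x * (u j * (E (p j) * (y * (u j * F (p j)))))
            = y * (u j * (F (p j) * (x * (u j * E (p j))))) := by
          rw [← (hy (E _)).left_comm, ← (hy (u j)).left_comm, (hx y).left_comm,
            ← (hx (F _)).left_comm, ← (hx (u j)).left_comm, ← mul_assoc (E _), hcE, mul_assoc, hCp,
            ← mul_assoc (F _), hcF, mul_assoc]
        rw [hE, hF]
        simp only [add_mul, mul_add, mul_assoc]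
        rw [hj, h1, ← (hy (E j)).left_comm, ← (hx (F j)).left_comm]
        refine sub_eq_zero.mp (Eq.trans ?_ (sub_eq_zero.mpr (hA j (hp j) le_rfl)))
        abel
    refine ⟨hC, exchange_initial hp hmono hcomm hcub hx hy hE₀ hE hF₀ hF j (fun i hi => ?_)
      fun k hk => (ih k hk).2⟩
    rcases hi.lt_or_eq with h | rfl
    · exact (ih i h).1
    · exact hC

end CommutingSeries

/-! ## Words without `P`-descents -/

section Words

variable {n : ℕ}

namespace NatUnitIntervalOrder

variable (P : NatUnitIntervalOrder n)

open Classical in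
/-- The number of elements `a` of `P` with `a <_P c`; they are exactly the `a` below this number. -/
noncomputable def below (c : ℕ) : ℕ := {a : Fin n | (P.m a : ℕ) < c}.toFinset.card

theorem below_le (c : ℕ) : P.below c ≤ c := by
  classical
  have h : ({a : Fin n | (P.m a : ℕ) < c}.toFinset.map Fin.valEmbedding) ⊆ Finset.range c := by
    intro i hi
    obtain ⟨a, ha, rfl⟩ := Finset.mem_map.mp hi
    rw [Set.mem_toFinset, Set.mem_ofPred_eq] at ha
    exact Finset.mem_range.mpr (lt_of_le_of_lt (P.le_m a) ha)
  simpa [below] using Finset.card_le_card h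

theorem below_mono : Monotone P.below := by
  intro c d h
  refine Finset.card_le_card fun a ha => ?_
  simp only [Set.mem_toFinset, Set.mem_ofPred_eq] at ha ⊢
  omega

theorem lt_below_iff (a : Fin n) (c : ℕ) : (a : ℕ) < P.below c ↔ (P.m a : ℕ) < c := by
  classical
  have hdown : ∀ b b' : Fin n, b ≤ b' → (P.m b' : ℕ) < c → (P.m b : ℕ) < c := fun b b' h h' =>
    lt_of_le_of_lt (P.mono h) h'
  constructor
  · intro h
    by_contra hc
    have h1 : {b : Fin n | (P.m b : ℕ) < c}.toFinset ⊆ Finset.Iio a := by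
      intro b hb
      rw [Set.mem_toFinset, Set.mem_ofPred_eq] at hb
      exact Finset.mem_Iio.mpr (not_le.mp fun hab => hc (hdown _ _ hab hb))
    have h2 := Finset.card_le_card h1
    rw [Fin.card_Iio] at h2
    rw [below] at h
    omega
  · intro h
    have h1 : Finset.Iic a ⊆ {b : Fin n | (P.m b : ℕ) < c}.toFinset := by
      intro b hb
      rw [Set.mem_toFinset, Set.mem_ofPred_eq]
      exact hdown _ _ (Finset.mem_Iic.mp hb) h
    have h2 := Finset.card_le_card h1
    rw [Fin.card_Iic] at h2
    rw [below]
    omega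

theorem lt_iff_below (a c : Fin n) : P.lt a c ↔ (a : ℕ) < P.below c := (P.lt_below_iff a c).symm

open Classical in
/-- Inserts the letter `a` in front of the word `w` and moves it past all smaller letters. -/
noncomputable def ins (a : Fin n) : List (Fin n) → List (Fin n)
  | [] => [a]
  | b :: w => if P.lt b a then b :: ins a w else a :: b :: w

/-- The first occurrence of the letter `a` in the word `w` is preceded by letters comparable to `a`
only. -/
def IsSinkLetter (a : Fin n) : List (Fin n) → Prop
  | [] => False
  | b :: w => a = b ∨ (P.lt a b ∨ P.lt b a) ∧ IsSinkLetter a w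

variable {P}

theorem length_ins (a : Fin n) (w : List (Fin n)) : (P.ins a w).length = w.length + 1 := by
  induction w with
  | nil => rfl
  | cons b w ih => rw [ins]; split_ifs <;> simp [ih]

theorem noPDescents_ins (a : Fin n) (w : List (Fin n)) (hw : NoPDescents P w) :
    NoPDescents P (P.ins a w) := by
  induction w with
  | nil => exact List.isChain_singleton a
  | cons b w ih =>
    rw [ins]
    split_ifs with h
    · have hw' := ih hw.tail
      cases w with
      | nil =>
        exact List.isChain_cons_cons.mpr
          ⟨fun h' => P.lt_irrefl _ (lt_trans h h'), List.isChain_singleton a⟩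
      | cons c w =>
        rw [ins] at hw' ⊢
        split_ifs at hw' ⊢ with hc
        · exact List.isChain_cons_cons.mpr ⟨(List.isChain_cons_cons.mp hw).1, hw'⟩
        · exact List.isChain_cons_cons.mpr ⟨fun h' => P.lt_irrefl _ (lt_trans h h'), hw'⟩
    · exact List.isChain_cons_cons.mpr ⟨h, hw⟩

theorem isSinkLetter_ins_self (a : Fin n) (w : List (Fin n)) : P.IsSinkLetter a (P.ins a w) := by
  induction w with
  | nil => exact Or.inl rfl
  | cons b w ih =>
    rw [ins]
    split_ifs with h
    · exact Or.inr ⟨Or.inr h, ih⟩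
    · exact Or.inl rfl

theorem erase_ins (a : Fin n) (w : List (Fin n)) : (P.ins a w).erase a = w := by
  induction w with
  | nil => simp [ins]
  | cons b w ih =>
    rw [ins]
    split_ifs with h
    · rw [List.erase_cons_tail, ih]
      simp only [beq_iff_eq]
      rintro rfl
      exact P.lt_irrefl _ h
    · simp

theorem not_isSinkLetter_of_lt {a b : Fin n} {w : List (Fin n)} (hw : NoPDescents P (b :: w))
    (h : P.lt a b) : ¬ P.IsSinkLetter a w := by
  induction w generalizing b with
  | nil => exact id
  | cons c w ih =>
    have hbc := (List.isChain_cons_cons.mp hw).1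
    rintro (rfl | ⟨h' | h', hs⟩)
    · exact hbc h
    · exact ih hw.tail h' hs
    · exact hbc (lt_trans h' h)

theorem ins_erase {a : Fin n} {w : List (Fin n)} (hw : NoPDescents P w) (h : P.IsSinkLetter a w) :
    P.ins a (w.erase a) = w := by
  induction w with
  | nil => exact h.elim
  | cons b w ih =>
    rcases h with rfl | ⟨h, hs⟩
    · rw [List.erase_cons_head]
      cases w with
      | nil => rfl
      | cons c w => rw [ins, if_neg (List.isChain_cons_cons.mp hw).1]
    · have hba := h.resolve_left fun h => not_isSinkLetter_of_lt hw h hs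
      rw [List.erase_cons_tail, ins, if_pos hba, ih hw.tail hs]
      simp only [beq_iff_eq]
      rintro rfl
      exact P.lt_irrefl _ hba

theorem noPDescents_erase {a : Fin n} {w : List (Fin n)} (hw : NoPDescents P w)
    (h : P.IsSinkLetter a w) : NoPDescents P (w.erase a) := by
  induction w with
  | nil => exact h.elim
  | cons b w ih =>
    rcases h with rfl | ⟨h, hs⟩
    · rw [List.erase_cons_head]
      exact hw.tail
    · have hba := h.resolve_left fun h => not_isSinkLetter_of_lt hw h hs
      have hne : ¬ (b == a) = true := by
        simp only [beq_iff_eq]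
        rintro rfl
        exact P.lt_irrefl _ hba
      have ih' := ih hw.tail hs
      rw [List.erase_cons_tail hne]
      cases w with
      | nil => exact List.isChain_singleton b
      | cons c w =>
        by_cases hca : c = a
        · subst hca
          rw [List.erase_cons_head] at ih' ⊢
          cases w with
          | nil => exact List.isChain_singleton b
          | cons d w =>
            have hd := (List.isChain_cons_cons.mp hw.tail).1
            exact List.isChain_cons_cons.mpr ⟨fun h' => hd (lt_trans h' hba), ih'⟩
        · rw [List.erase_cons_tail (by simpa using hca)] at ih' ⊢
          exact List.isChain_cons_cons.mpr ⟨(List.isChain_cons_cons.mp hw).1, ih'⟩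

theorem isSinkLetter_ins_iff {a b : Fin n} (h : P.lt b a) (w : List (Fin n)) :
    P.IsSinkLetter b (P.ins a w) ↔ P.IsSinkLetter b w := by
  have hne : b ≠ a := by rintro rfl; exact P.lt_irrefl _ h
  induction w with
  | nil => simp [ins, IsSinkLetter, hne]
  | cons c w ih =>
    rw [ins]
    split_ifs with hc
    · simp only [IsSinkLetter, ih]
    · simp only [IsSinkLetter, hne, h, false_or, true_or, true_and]

theorem IsSinkLetter.comparable {a b : Fin n} {w : List (Fin n)} (ha : P.IsSinkLetter a w)
    (hb : P.IsSinkLetter b w) : a = b ∨ P.lt a b ∨ P.lt b a := by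
  induction w with
  | nil => exact ha.elim
  | cons c w ih =>
    rcases ha with rfl | ⟨h, ha⟩ <;> rcases hb with rfl | ⟨h', hb⟩
    · exact Or.inl rfl
    · exact Or.inr h'.symm
    · exact Or.inr h
    · exact ih ha hb

variable (P) in
open Classical in
/-- The number of letters below `r` that are sinks of the word `w`. -/
noncomputable def sinkCount (r : ℕ) (w : List (Fin n)) : ℕ :=
  {a : Fin n | (a : ℕ) < r ∧ P.IsSinkLetter a w}.toFinset.card

theorem sinkCount_pos {w : List (Fin n)} (hw : w ≠ []) : 0 < P.sinkCount n w := by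
  classical
  cases w with
  | nil => exact absurd rfl hw
  | cons a w => exact Finset.card_pos.mpr ⟨a, by simp [IsSinkLetter]⟩

theorem sinkCount_le_length (r : ℕ) (w : List (Fin n)) : P.sinkCount r w ≤ w.length := by
  classical
  have hmem : ∀ (a : Fin n) (w : List (Fin n)), P.IsSinkLetter a w → a ∈ w := by
    intro a w
    induction w with
    | nil => exact False.elim
    | cons b w ih =>
      rintro (rfl | ⟨_, h⟩)
      · exact List.mem_cons_self
      · exact List.mem_cons_of_mem _ (ih h)
  refine (Finset.card_le_card fun a ha => ?_).trans w.toFinset_card_le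
  rw [Set.mem_toFinset] at ha
  exact List.mem_toFinset.mpr (hmem a w ha.2)

open Classical in
theorem sinkCount_succ (c : Fin n) (w : List (Fin n)) :
    P.sinkCount (c + 1) w = P.sinkCount c w + if P.IsSinkLetter c w then 1 else 0 := by
  rw [sinkCount, sinkCount]
  split_ifs with h
  · have : {a : Fin n | (a : ℕ) < (c : ℕ) + 1 ∧ P.IsSinkLetter a w}.toFinset
        = insert c {a : Fin n | (a : ℕ) < (c : ℕ) ∧ P.IsSinkLetter a w}.toFinset := by
      ext a
      simp only [Set.mem_toFinset, Set.mem_ofPred_eq, Finset.mem_insert]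
      constructor
      · rintro ⟨h1, h2⟩
        rcases (Nat.lt_succ_iff.mp h1).eq_or_lt with h3 | h3
        · exact Or.inl (Fin.ext h3)
        · exact Or.inr ⟨h3, h2⟩
      · rintro (rfl | ⟨h1, h2⟩)
        · exact ⟨by omega, h⟩
        · exact ⟨by omega, h2⟩
    rw [this, Finset.card_insert_of_notMem (by simp)]
  · rw [add_zero]
    congr 1
    ext a
    simp only [Set.mem_toFinset, Set.mem_ofPred_eq]
    constructor
    · rintro ⟨h1, h2⟩
      refine ⟨lt_of_le_of_ne (Nat.lt_succ_iff.mp h1) fun h3 => h ?_, h2⟩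
      rwa [← Fin.ext h3]
    · rintro ⟨h1, h2⟩
      exact ⟨by omega, h2⟩

theorem sinkCount_ins (c : Fin n) (w : List (Fin n)) :
    P.sinkCount (P.below c) w = P.sinkCount c (P.ins c w) := by
  rw [sinkCount, sinkCount]
  congr 1
  ext a
  simp only [Set.mem_toFinset, Set.mem_ofPred_eq, ← lt_iff_below]
  constructor
  · rintro ⟨h1, h2⟩
    exact ⟨lt_imp_lt h1, (isSinkLetter_ins_iff h1 w).mpr h2⟩
  · rintro ⟨h1, h2⟩
    have h3 : P.lt a c := by
      rcases h2.comparable (isSinkLetter_ins_self c w) with rfl | h | h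
      · exact absurd h1 (_root_.lt_irrefl _)
      · exact h
      · exact absurd (lt_imp_lt h) (not_lt.mpr h1.le)
    exact ⟨h3, (isSinkLetter_ins_iff h3 w).mp h2⟩

variable (P) in
open Classical in
/-- The words of length `d` without `P`-descents. -/
noncomputable def normalWords (d : ℕ) : Finset (List (Fin n)) :=
  {w ∈ (List.finite_length_eq (Fin n) d).toFinset | NoPDescents P w}

theorem mem_normalWords {d : ℕ} {w : List (Fin n)} :
    w ∈ P.normalWords d ↔ w.length = d ∧ NoPDescents P w := by
  classical
  rw [normalWords, Finset.mem_filter, Set.Finite.mem_toFinset, Set.mem_ofPred_eq]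

end NatUnitIntervalOrder

end Words

/-! ## Chains and words in a ring -/

section ChainSums

variable {n : ℕ} {A : Type*} [Ring A] (P : NatUnitIntervalOrder n) (U : Fin n → A)

/-- Evaluation of a word in a ring. -/
def wordEval (w : List (Fin n)) : A := (w.map U).prod

/-- The family `U` extended by zero. -/
def extendZero (a : ℕ) : A := if h : a < n then U ⟨a, h⟩ else 0

/-- The sum of the products over all `P`-descending chains of length `k` below `r`. -/
noncomputable def chainSum : ℕ → ℕ → A
  | 0, _ => 1
  | k + 1, r => ∑ s ∈ Finset.range r, extendZero U s * chainSum k (P.below s)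

theorem chainSum_succ_succ (k r : ℕ) :
    chainSum P U (k + 1) (r + 1)
      = chainSum P U (k + 1) r + extendZero U r * chainSum P U k (P.below r) := by
  rw [chainSum, Finset.sum_range_succ, ← chainSum]

variable {P U}

theorem wordEval_ins (hU : ∀ a c, P.lt a c → U a * U c = U c * U a) (a : Fin n)
    (w : List (Fin n)) : wordEval U (P.ins a w) = U a * wordEval U w := by
  induction w with
  | nil => simp [wordEval, NatUnitIntervalOrder.ins]
  | cons b w ih =>
    rw [NatUnitIntervalOrder.ins]
    split_ifs with h
    · have h1 : wordEval U (b :: P.ins a w) = U b * wordEval U (P.ins a w) := by simp [wordEval]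
      have h2 : wordEval U (b :: w) = U b * wordEval U w := by simp [wordEval]
      rw [h1, h2, ih, ← mul_assoc, hU b a h, mul_assoc]
    · simp [wordEval]

/-- A product of a sum over chains and the sum over all normal words counts the normal words by
subsets of their sinks. -/
theorem chainSum_mul_normalWords (hU : ∀ a c, P.lt a c → U a * U c = U c * U a) (r : ℕ)
    (hr : r ≤ n) (i j : ℕ) :
    chainSum P U i r * ∑ w ∈ P.normalWords j, wordEval U w
      = ∑ w ∈ P.normalWords (i + j), (P.sinkCount r w).choose i • wordEval U w := by
  classical
  induction r using Nat.strong_induction_on generalizing i with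
  | _ r ih =>
    cases i with
    | zero => simp [chainSum]
    | succ i =>
      cases r with
      | zero =>
        rw [chainSum, Finset.range_zero, Finset.sum_empty, zero_mul]
        refine (Finset.sum_eq_zero fun w _ => ?_).symm
        simp [NatUnitIntervalOrder.sinkCount]
      | succ r =>
        have hb := P.below_le r
        obtain ⟨c, rfl⟩ : ∃ c : Fin n, (c : ℕ) = r := ⟨⟨r, by omega⟩, rfl⟩
        have hc : extendZero U c = U c := by simp [extendZero]
        rw [chainSum_succ_succ, add_mul, mul_assoc, ih c (by omega) (by omega),
          ih (P.below c) (by omega) (by omega), hc, Finset.mul_sum]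
        have h1 : ∑ w ∈ P.normalWords (i + j),
              U c * ((P.sinkCount (P.below c) w).choose i • wordEval U w)
            = ∑ w ∈ P.normalWords (i + 1 + j) with P.IsSinkLetter c w,
              (P.sinkCount c w).choose i • wordEval U w := by
          refine Finset.sum_bij' (fun w _ => P.ins c w) (fun w _ => w.erase c) ?_ ?_ ?_ ?_ ?_
          · intro w hw
            rw [NatUnitIntervalOrder.mem_normalWords] at hw
            rw [Finset.mem_filter, NatUnitIntervalOrder.mem_normalWords,
              NatUnitIntervalOrder.length_ins]
            exact ⟨⟨by omega, NatUnitIntervalOrder.noPDescents_ins c w hw.2⟩,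
              NatUnitIntervalOrder.isSinkLetter_ins_self c w⟩
          · intro w hw
            rw [Finset.mem_filter, NatUnitIntervalOrder.mem_normalWords] at hw
            have hl := congrArg List.length (NatUnitIntervalOrder.ins_erase hw.1.2 hw.2)
            rw [NatUnitIntervalOrder.length_ins] at hl
            rw [NatUnitIntervalOrder.mem_normalWords]
            exact ⟨by omega, NatUnitIntervalOrder.noPDescents_erase hw.1.2 hw.2⟩
          · intro w _
            exact NatUnitIntervalOrder.erase_ins c w
          · intro w hw
            rw [Finset.mem_filter, NatUnitIntervalOrder.mem_normalWords] at hw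
            exact NatUnitIntervalOrder.ins_erase hw.1.2 hw.2
          · intro w _
            rw [mul_smul_comm, wordEval_ins hU, NatUnitIntervalOrder.sinkCount_ins]
        rw [h1, Finset.sum_filter, ← Finset.sum_add_distrib]
        refine Finset.sum_congr rfl fun w _ => ?_
        rw [NatUnitIntervalOrder.sinkCount_succ]
        split_ifs
        · rw [Nat.choose_succ_succ, add_smul, add_comm]
        · rw [add_zero, add_zero]

/-- The sums over `P`-descending chains of given lengths commute. -/
theorem chainSum_commute (hU : ∀ a c, P.lt a c → U a * U c = U c * U a)
    (hU' : ∀ a b c, a < b → b < c → ¬ P.lt a b → ¬ P.lt b c → P.lt a c →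
      U a * U c * U b = U b * U a * U c) (i j r : ℕ) :
    Commute (chainSum P U i r) (chainSum P U j r) := by
  let C₁ : PowerSeries A →+* PowerSeries (PowerSeries A) := PowerSeries.C
  let C₂ : A →+* PowerSeries A := PowerSeries.C
  let u : ℕ → PowerSeries (PowerSeries A) := fun s => C₁ (C₂ (extendZero U s))
  let E : ℕ → PowerSeries (PowerSeries A) := fun r =>
    C₁ (PowerSeries.mk fun k => chainSum P U k r)
  let F : ℕ → PowerSeries (PowerSeries A) := fun r =>
    PowerSeries.mk fun k => C₂ (chainSum P U k r)
  have hx : ∀ z, Commute (C₁ PowerSeries.X) z := by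
    intro z
    ext k : 1
    simp only [C₁, PowerSeries.coeff_C_mul, PowerSeries.coeff_mul_C]
    exact (PowerSeries.commute_X _).symm.eq
  have hy : ∀ z, Commute (PowerSeries.X : PowerSeries (PowerSeries A)) z := fun z =>
    (PowerSeries.commute_X z).symm
  have hext : ∀ a, n ≤ a → extendZero U a = 0 := fun a ha => dif_neg (by omega)
  have hval : ∀ a (h : a < n), extendZero U a = U ⟨a, h⟩ := fun a h => dif_pos h
  have h := (initial_mul_comm (u := u) (p := P.below) (x := C₁ PowerSeries.X)
    (y := PowerSeries.X) (E := E) (F := F) P.below_le P.below_mono ?_ ?_ hx hy ?_ ?_ ?_ ?_ r).1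
  · have := congrArg (fun z => PowerSeries.coeff i (PowerSeries.coeff j z)) h
    simp only [E, F, C₁, C₂, PowerSeries.coeff_C_mul, PowerSeries.coeff_mul_C,
      PowerSeries.coeff_mk] at this
    exact this
  · intro a c hac
    refine (?_ : Commute (extendZero U a) (extendZero U c)).map (C₁.comp C₂)
    by_cases hc : c < n
    · have ha : a < n := by have := P.below_le c; omega
      rw [hval a ha, hval c hc]
      exact hU _ _ ((P.lt_iff_below _ _).mpr hac)
    · rw [hext c (by omega)]
      exact Commute.zero_right _
  · intro a b c hab hbc hba hcb hac
    suffices h : extendZero U a * extendZero U c * extendZero U b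
        = extendZero U b * extendZero U a * extendZero U c by
      simpa only [map_mul] using! congrArg (C₁.comp C₂) h
    by_cases hc : c < n
    · rw [hval a (by omega), hval b (by omega), hval c hc]
      exact hU' _ _ _ hab hbc (fun h => absurd ((P.lt_iff_below _ _).mp h) (not_lt.mpr hba))
        (fun h => absurd ((P.lt_iff_below _ _).mp h) (not_lt.mpr hcb)) ((P.lt_iff_below _ _).mpr hac)
    · rw [hext c (by omega)]
      simp
  · refine (congrArg C₁ ?_).trans (map_one C₁)
    ext k
    cases k <;> simp [chainSum, PowerSeries.coeff_one]
  · intro r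
    simp only [E, u, ← map_mul, ← map_add]
    congr 1
    ext k
    cases k with
    | zero => simp [chainSum]
    | succ k => simp [chainSum_succ_succ, PowerSeries.coeff_succ_X_mul, C₂]
  · ext k : 1
    cases k <;> simp [chainSum, PowerSeries.coeff_one, F, C₂]
  · intro r
    ext k : 1
    cases k with
    | zero => simp [chainSum, F]
    | succ k => simp [chainSum_succ_succ, PowerSeries.coeff_succ_X_mul, F, u, C₁]

end ChainSums

/-! ## Symmetric polynomials -/

section SymmetricPolynomials

open MvPolynomial

theorem sum_single_one_apply {σ : Type*} [DecidableEq σ] (T : Finset σ) (j : σ) :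
    (∑ i ∈ T, Finsupp.single i 1 : σ →₀ ℕ) j = if j ∈ T then 1 else 0 := by
  simp [Finsupp.finsetSum_apply, Finsupp.single_apply]

theorem coeff_hsymm {N : ℕ} (j : ℕ) (t : Fin N →₀ ℕ) :
    coeff t (hsymm (Fin N) ℤ j) = if t.degree = j then 1 else 0 := by
  classical
  have hdeg : ∀ a : Multiset (Fin N), a.toFinsupp.degree = a.card := by
    intro a
    rw [← Multiset.toFinsupp_sum_eq]
    rfl
  have hterm : ∀ a : Sym (Fin N) j, coeff t (a.1.map (X : Fin N → MvPolynomial (Fin N) ℤ)).prod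
      = if a.1.toFinsupp = t then 1 else 0 := by
    intro a
    rw [prod_X_eq_monomial, coeff_monomial]
  rw [hsymm, coeff_sum]
  refine (Finset.sum_congr rfl fun a _ => hterm a).trans ?_
  split_ifs with h
  · have hc : t.toMultiset.card = j := by
      rw [← hdeg, Finsupp.toMultiset_toFinsupp, h]
    refine (Finset.sum_eq_single (⟨t.toMultiset, hc⟩ : Sym (Fin N) j) ?_ ?_).trans ?_
    · intro b _ hb
      refine if_neg fun hbt => hb (Subtype.ext ?_)
      simp [← hbt]
    · exact fun h => absurd (Finset.mem_univ (α := Sym (Fin N) j) _) h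
    · simp
  · refine Finset.sum_eq_zero fun a _ => if_neg fun hat => h ?_
    rw [← hat, hdeg, a.2]

theorem coeff_esymm_mul_hsymm {N : ℕ} (i j : ℕ) (t : Fin N →₀ ℕ) :
    coeff t (esymm (Fin N) ℤ i * hsymm (Fin N) ℤ j)
      = if t.degree = i + j then (t.support.card.choose i : ℤ) else 0 := by
  classical
  have hle : ∀ T : Finset (Fin N),
      (∑ i ∈ T, Finsupp.single i 1 : Fin N →₀ ℕ) ≤ t ↔ T ⊆ t.support := by
    intro T
    constructor
    · intro h a ha
      have := h a
      rw [sum_single_one_apply, if_pos ha] at this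
      rw [Finsupp.mem_support_iff]
      omega
    · intro h a
      rw [sum_single_one_apply]
      split_ifs with ha
      · exact Nat.one_le_iff_ne_zero.mpr (Finsupp.mem_support_iff.mp (h ha))
      · exact Nat.zero_le _
  have key : ∀ T ∈ Finset.powersetCard i (Finset.univ : Finset (Fin N)),
      coeff t (monomial (∑ i ∈ T, Finsupp.single i 1) 1 * hsymm (Fin N) ℤ j)
        = if T ⊆ t.support then (if t.degree = i + j then 1 else 0) else 0 := by
    intro T hT
    rw [coeff_monomial_mul']
    by_cases h : T ⊆ t.support
    · rw [if_pos h, if_pos ((hle T).mpr h), one_mul, coeff_hsymm]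
      have hd := congrArg Finsupp.degree (tsub_add_cancel_of_le ((hle T).mpr h))
      rw [map_add, map_sum] at hd
      simp only [Finsupp.degree_single, Finset.sum_const, smul_eq_mul, mul_one,
        (Finset.mem_powersetCard.mp hT).2] at hd
      exact if_congr (by omega) rfl rfl
    · rw [if_neg h, if_neg fun h' => h ((hle T).mp h')]
  rw [esymm_eq_sum_monomial, Finset.sum_mul, coeff_sum, Finset.sum_congr rfl key,
    ← Finset.sum_filter, Finset.sum_const]
  have : (Finset.powersetCard i (Finset.univ : Finset (Fin N))).filter (· ⊆ t.support)
      = Finset.powersetCard i t.support := by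
    ext T
    simp [Finset.mem_powersetCard, and_comm]
  rw [this, Finset.card_powersetCard]
  split_ifs <;> simp

theorem coeff_msymm {d : ℕ} (l : d.Partition) (t : Fin d →₀ ℕ)
    [Decidable (t.support.val.map t = l.parts)] :
    coeff t (msymm (Fin d) ℤ l) = if t.support.val.map t = l.parts then 1 else 0 := by
  rw [← coeff_coe, msymm_coe_eq_monoSymm, coeff_monoSymm]

/-- The partition given by the nonzero entries of an exponent vector. -/
noncomputable def exponentPartition {σ : Type*} {d : ℕ} (t : σ →₀ ℕ) (h : t.degree = d) :
    d.Partition where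
  parts := t.support.val.map t
  parts_pos := by
    intro i hi
    obtain ⟨a, ha, rfl⟩ := Multiset.mem_map.mp hi
    exact Nat.pos_of_ne_zero (Finsupp.mem_support_iff.mp ha)
  parts_sum := h

theorem esymm_mul_hsymm_eq_sum {d i j : ℕ} (h : i + j = d) :
    esymm (Fin d) ℤ i * hsymm (Fin d) ℤ j
      = ∑ l : d.Partition, l.parts.card.choose i • msymm (Fin d) ℤ l := by
  classical
  ext t
  rw [coeff_esymm_mul_hsymm, coeff_sum, h]
  simp only [coeff_smul, coeff_msymm]
  split_ifs with ht
  · obtain ⟨l, hl⟩ : ∃ l : d.Partition, t.support.val.map t = l.parts :=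
      ⟨exponentPartition t ht, rfl⟩
    rw [Finset.sum_eq_single l]
    · rw [if_pos hl, ← hl, Multiset.card_map]
      simp
    · intro l' _ hne
      rw [if_neg, smul_zero]
      intro h'
      exact hne (Nat.Partition.ext (h'.symm.trans hl))
    · simp
  · refine (Finset.sum_eq_zero fun l _ => ?_).symm
    rw [if_neg, smul_zero]
    intro h'
    apply ht
    refine Eq.trans ?_ l.parts_sum
    rw [← h']
    rfl

theorem alternating_esymm_mul_hsymm {N m : ℕ} (hm : m ≠ 0) :
    ∑ i ∈ Finset.range (m + 1), (-1 : ℤ) ^ i • (esymm (Fin N) ℤ i * hsymm (Fin N) ℤ (m - i)) = 0 := by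
  classical
  ext t
  rw [coeff_sum]
  simp only [coeff_smul, coeff_esymm_mul_hsymm, coeff_zero]
  have hi : ∀ i ∈ Finset.range (m + 1), (-1 : ℤ) ^ i •
        (if t.degree = i + (m - i) then (t.support.card.choose i : ℤ) else 0)
      = if t.degree = m then (-1 : ℤ) ^ i * (t.support.card.choose i : ℤ) else 0 := by
    intro i hi
    rw [Nat.add_sub_cancel' (Nat.lt_succ_iff.mp (Finset.mem_range.mp hi))]
    split_ifs <;> simp
  rw [Finset.sum_congr rfl hi]
  split_ifs with h
  · have hc : t.support.card ≤ m := by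
      rw [← h, Finsupp.degree, Finset.card_eq_sum_ones]
      exact Finset.sum_le_sum fun i hi => Nat.one_le_iff_ne_zero.mpr (Finsupp.mem_support_iff.mp hi)
    have h0 : t.support.card ≠ 0 := by
      rw [Ne, Finset.card_eq_zero, Finsupp.support_eq_empty]
      rintro rfl
      exact hm (by simpa using h.symm)
    rw [← Finset.sum_subset (Finset.range_subset_range.mpr (Nat.succ_le_succ hc)),
      Int.alternating_sum_range_choose, if_neg h0]
    intro i _ hi
    rw [Nat.choose_eq_zero_of_lt (by simpa using hi)]
    simp
  · simp

/-! ### The transition matrix is symmetric -/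

/-- The parts of a partition of `d`, padded by zeros to a vector of length `d`. -/
theorem exists_partVec {d : ℕ} (l : d.Partition) :
    ∃ v : Fin d → ℕ, (Finset.univ : Finset (Fin d)).val.map v
      = l.parts + Multiset.replicate (d - l.parts.card) 0 := by
  have hc : l.parts.card ≤ d := by
    conv_rhs => rw [← l.parts_sum]
    simpa using Multiset.card_nsmul_le_sum (s := l.parts) (a := 1) fun x hx => l.parts_pos hx
  have hcard : (l.parts + Multiset.replicate (d - l.parts.card) 0).card = d := by
    rw [Multiset.card_add, Multiset.card_replicate]
    omega
  generalize l.parts + Multiset.replicate (d - l.parts.card) 0 = s at hcard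
  induction s using Quotient.inductionOn with
  | _ L =>
    have hlen : L.length = d := hcard
    subst hlen
    exact ⟨L.get, by simp [Fin.univ_val_map]⟩

/-- The parts of a partition of `d`, padded by zeros to a vector of length `d`. -/
noncomputable def partVec {d : ℕ} (l : d.Partition) : Fin d →₀ ℕ :=
  Finsupp.equivFunOnFinite.symm (exists_partVec l).choose

theorem map_partVec {d : ℕ} (l : d.Partition) : (Finset.univ : Finset (Fin d)).val.map (partVec l)
      = l.parts + Multiset.replicate (d - l.parts.card) 0 :=
  (exists_partVec l).choose_spec

theorem support_map_partVec {d : ℕ} (l : d.Partition) :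
    (partVec l).support.val.map (partVec l) = l.parts := by
  classical
  have h : (partVec l).support = Finset.univ.filter fun i => partVec l i ≠ 0 := by
    ext i
    simp
  rw [h, Finset.filter_val]
  refine (Multiset.filter_map (fun a => a ≠ 0) (partVec l) _).symm.trans ?_
  rw [map_partVec, Multiset.filter_add,
    Multiset.filter_eq_self.mpr fun a ha => (l.parts_pos ha).ne',
    Multiset.filter_eq_nil.mpr, add_zero]
  intro a ha
  simp [Multiset.eq_of_mem_replicate ha]

theorem esymmPart_eq_prod_partVec {d : ℕ} (l : d.Partition) :
    esymmPart (Fin d) ℤ l = ∏ i, esymm (Fin d) ℤ (partVec l i) := by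
  have h := congrArg (fun s => (s.map (esymm (Fin d) ℤ)).prod) (map_partVec l)
  simp only [Multiset.map_map, Multiset.map_add, Multiset.prod_add, Multiset.map_replicate,
    esymm_zero, Multiset.prod_replicate, one_pow, mul_one] at h
  exact h.symm

open Classical in
theorem coeff_esymmPart {d : ℕ} (l : d.Partition) (t : Fin d →₀ ℕ) :
    coeff t (esymmPart (Fin d) ℤ l)
      = ({T : Fin d → Finset (Fin d) | (∀ i, (T i).card = partVec l i) ∧
          ∀ j, (Finset.univ.filter fun i => j ∈ T i).card = t j} : Finset _).card := by
  rw [esymmPart_eq_prod_partVec]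
  simp only [esymm_eq_sum_monomial]
  rw [Finset.prod_univ_sum, coeff_sum]
  simp only [← monomial_sum_one, coeff_monomial]
  rw [← Finset.sum_filter, Finset.sum_const, nsmul_eq_mul, mul_one]
  congr 2
  ext T
  simp only [Finset.mem_filter, Fintype.mem_piFinset, Finset.mem_powersetCard_univ,
    Finset.mem_univ, true_and]
  refine and_congr Iff.rfl ?_
  rw [Finsupp.ext_iff]
  refine forall_congr' fun j => ?_
  rw [Finsupp.finsetSum_apply]
  simp only [sum_single_one_apply]
  rw [Finset.card_filter]

theorem coeff_esymmPart_symm {d : ℕ} (l l' : d.Partition) :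
    coeff (partVec l') (esymmPart (Fin d) ℤ l) = coeff (partVec l) (esymmPart (Fin d) ℤ l') := by
  classical
  rw [coeff_esymmPart, coeff_esymmPart]
  congr 1
  refine Finset.card_bij' (fun T _ j => Finset.univ.filter fun i => j ∈ T i)
    (fun T _ j => Finset.univ.filter fun i => j ∈ T i) ?_ ?_ ?_ ?_
  · intro T hT
    simp only [Finset.mem_filter, Finset.mem_univ, true_and, Finset.filter_univ_mem] at hT ⊢
    exact ⟨hT.2, hT.1⟩
  · intro T hT
    simp only [Finset.mem_filter, Finset.mem_univ, true_and, Finset.filter_univ_mem] at hT ⊢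
    exact ⟨hT.2, hT.1⟩
  · intro T _
    simp
  · intro T _
    simp

/-- The coefficients of elementary in terms of monomial symmetric functions. -/
noncomputable def elemToMono (d : ℕ) : Matrix d.Partition d.Partition ℤ :=
  Matrix.of fun l l' => coeff (partVec l') (esymmPart (Fin d) ℤ l)

theorem monoToElem_mul_elemToMono (d : ℕ) :
    Matrix.of (monoToElem (d := d)) * elemToMono d = 1 := by
  classical
  ext l l'
  rw [Matrix.mul_apply, Matrix.one_apply]
  have h := congrArg (coeff (partVec l')) (msymm_eq_sum l)
  rw [coeff_msymm, support_map_partVec, coeff_sum] at h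
  simp only [coeff_smul, smul_eq_mul] at h
  refine h.symm.trans (if_congr ⟨fun h => (Nat.Partition.ext h).symm, fun h => ?_⟩ rfl rfl)
  rw [h]

theorem elemToMono_mul_monoToElem (d : ℕ) :
    elemToMono d * Matrix.of (monoToElem (d := d)) = 1 :=
  mul_eq_one_comm.mp (monoToElem_mul_elemToMono d)

theorem monoToElem_symm {d : ℕ} (l l' : d.Partition) : monoToElem l l' = monoToElem l' l := by
  have hB : (elemToMono d).transpose = elemToMono d := by
    ext l l'
    exact coeff_esymmPart_symm l' l
  have h := congrArg Matrix.transpose (monoToElem_mul_elemToMono d)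
  rw [Matrix.transpose_mul, hB, Matrix.transpose_one] at h
  have h' := left_inv_eq_right_inv (monoToElem_mul_elemToMono d) h
  exact congrFun (congrFun h' l) l'

end SymmetricPolynomials

/-! ## Specializing symmetric polynomials to commuting elements -/

section Specialization

open MvPolynomial

open scoped IsMulCommutative in
theorem exists_esymm_specialization {A : Type*} [Ring A] (e : ℕ → A) (he₀ : e 0 = 1)
    (he : ∀ i j, Commute (e i) (e j)) (d : ℕ) :
    ∃ Ψ : symmetricSubalgebra (Fin d) ℤ →+* A,
      ∀ k ≤ d, Ψ ⟨esymm (Fin d) ℤ k, esymm_isSymmetric (Fin d) ℤ k⟩ = e k := by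
  have : IsMulCommutative (Subring.closure (Set.range e)) := Subring.isMulCommutative_closure (by
    rintro _ ⟨i, rfl⟩ _ ⟨j, rfl⟩
    exact (he i j).eq)
  let e' : ℕ → Subring.closure (Set.range e) := fun k => ⟨e k, Subring.subset_closure ⟨k, rfl⟩⟩
  let ι : Subring.closure (Set.range e) →+* A := (Subring.closure (Set.range e)).subtype
  let φ : MvPolynomial (Fin d) ℤ →+* Subring.closure (Set.range e) :=
    eval₂Hom (Int.castRingHom _) fun i : Fin d => e' (i + 1)
  let s := (esymmAlgEquiv (Fin d) ℤ (Fintype.card_fin d)).symm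
  refine ⟨(ι.comp φ).comp (s : symmetricSubalgebra (Fin d) ℤ →+* MvPolynomial (Fin d) ℤ),
    fun k hk => ?_⟩
  cases k with
  | zero =>
    have : (⟨esymm (Fin d) ℤ 0, esymm_isSymmetric (Fin d) ℤ 0⟩ : symmetricSubalgebra (Fin d) ℤ)
        = 1 := Subtype.ext (esymm_zero (Fin d) ℤ)
    rw [this, map_one, he₀]
  | succ k =>
    have : s ⟨esymm (Fin d) ℤ (k + 1), esymm_isSymmetric (Fin d) ℤ (k + 1)⟩ = X ⟨k, hk⟩ := by
      rw [AlgEquiv.symm_apply_eq]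
      refine Subtype.ext ?_
      rw [esymmAlgEquiv_apply]
      refine Eq.trans ?_ (esymmAlgHom_apply ..).symm
      rw [aeval_X]
    have h2 : φ (X ⟨k, hk⟩) = e' (k + 1) := eval₂Hom_X' _ _ _
    change ι (φ (s _)) = _
    rw [this, h2]
    rfl

/-- If `∑ (-1)^i e_i H_{m-i} = 0`, then the elements `e_i H_{d-i}` count monomial symmetric
functions by subsets of parts. -/
theorem sum_choose_monomial {A : Type*} [Ring A] (e H : ℕ → A) (he₀ : e 0 = 1) (hH₀ : H 0 = 1)
    (he : ∀ i j, Commute (e i) (e j))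
    (hH : ∀ m, m ≠ 0 → ∑ i ∈ Finset.range (m + 1), (-1 : ℤ) ^ i • (e i * H (m - i)) = 0)
    {d i : ℕ} (hi : i ≤ d) :
    ∑ l : d.Partition, l.parts.card.choose i •
        ∑ ν : d.Partition, monoToElem l ν • ((ν.parts.sort (· ≥ ·)).map e).prod
      = e i * H (d - i) := by
  obtain ⟨Ψ, hΨ⟩ := exists_esymm_specialization e he₀ he d
  let E : ℕ → symmetricSubalgebra (Fin d) ℤ := fun k =>
    ⟨esymm (Fin d) ℤ k, esymm_isSymmetric (Fin d) ℤ k⟩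
  let h : ℕ → symmetricSubalgebra (Fin d) ℤ := fun k =>
    ⟨hsymm (Fin d) ℤ k, hsymm_isSymmetric (Fin d) ℤ k⟩
  let M : d.Partition → symmetricSubalgebra (Fin d) ℤ := fun l =>
    ⟨msymm (Fin d) ℤ l, msymm_isSymmetric (Fin d) ℤ l⟩
  have hM : ∀ l, Ψ (M l)
      = ∑ ν : d.Partition, monoToElem l ν • ((ν.parts.sort (· ≥ ·)).map e).prod := by
    intro l
    have h1 : M l = ∑ ν : d.Partition, monoToElem l ν • ((ν.parts.sort (· ≥ ·)).map E).prod := by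
      refine Subtype.ext ?_
      refine (msymm_eq_sum l).trans ?_
      rw [AddSubmonoidClass.coe_finsetSum]
      refine Finset.sum_congr rfl fun ν _ => ?_
      change _ = monoToElem l ν • (((ν.parts.sort (· ≥ ·)).map E).prod : MvPolynomial (Fin d) ℤ)
      congr 1
      rw [SubmonoidClass.coe_list_prod, List.map_map, esymmPart]
      conv_lhs => rw [← Multiset.sort_eq ν.parts (· ≥ ·)]
      rw [Multiset.map_coe, Multiset.prod_coe]
      rfl
    rw [h1, map_sum]
    refine Finset.sum_congr rfl fun ν _ => ?_
    rw [map_zsmul, map_list_prod, List.map_map]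
    congr 2
    refine List.map_congr_left fun k hk => hΨ k ?_
    exact ν.le_of_mem_parts ((Multiset.mem_sort _).mp hk)
  have hh : ∀ m, m ≤ d → Ψ (h m) = H m := by
    intro m
    induction m using Nat.strong_induction_on with
    | _ m ih =>
      intro hm
      rcases eq_or_ne m 0 with rfl | hm0
      · have : h 0 = 1 := Subtype.ext (hsymm_zero (Fin d) ℤ)
        rw [this, map_one, hH₀]
      · have h1 : ∑ i ∈ Finset.range (m + 1), (-1 : ℤ) ^ i • (E i * h (m - i)) = 0 := by
          refine Subtype.ext ?_
          rw [AddSubmonoidClass.coe_finsetSum]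
          exact alternating_esymm_mul_hsymm hm0
        have h2 := congrArg Ψ h1
        have h3 := hH m hm0
        rw [map_sum, map_zero, Finset.sum_range_succ'] at h2
        rw [Finset.sum_range_succ'] at h3
        have h4 : ∑ i ∈ Finset.range m, Ψ ((-1 : ℤ) ^ (i + 1) • (E (i + 1) * h (m - (i + 1))))
            = ∑ i ∈ Finset.range m, (-1 : ℤ) ^ (i + 1) • (e (i + 1) * H (m - (i + 1))) := by
          refine Finset.sum_congr rfl fun i hi => ?_
          have := Finset.mem_range.mp hi
          rw [map_zsmul, map_mul, ih _ (by omega) (by omega), hΨ _ (by omega)]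
        rw [h4, ← h3] at h2
        have h5 := add_left_cancel h2
        rw [map_zsmul, map_mul, hΨ 0 (Nat.zero_le _), he₀] at h5
        simpa using h5
  have key : E i * h (d - i) = ∑ l : d.Partition, l.parts.card.choose i • M l := by
    refine Subtype.ext ?_
    rw [AddSubmonoidClass.coe_finsetSum]
    exact esymm_mul_hsymm_eq_sum (Nat.add_sub_cancel' hi)
  have := congrArg Ψ key
  rw [map_mul, hΨ i hi, hh _ (Nat.sub_le _ _), map_sum] at this
  rw [this]
  exact Finset.sum_congr rfl fun l _ => by rw [map_nsmul, hM]

/-- Binomial inversion. -/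
theorem eq_of_sum_choose_eq {A : Type*} [AddCommGroup A] (d : ℕ) (D : ℕ → A)
    (h : ∀ i ≤ d, ∑ k ∈ Finset.range (d + 1), k.choose i • D k = 0) : ∀ k ≤ d, D k = 0 := by
  suffices ∀ j k, k ≤ d → d - k = j → D k = 0 from fun k hk => this _ k hk rfl
  intro j
  induction j using Nat.strong_induction_on with
  | _ j ih =>
    rintro k hk rfl
    have h1 := h k hk
    rw [Finset.sum_eq_single k] at h1
    · simpa using h1
    · intro i hi hik
      have hi' := Finset.mem_range.mp hi
      rcases hik.lt_or_gt with h2 | h2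
      · rw [Nat.choose_eq_zero_of_lt h2, zero_smul]
      · rw [ih (d - i) (by omega) i (by omega) rfl, smul_zero]
    · intro hn
      exact absurd (Finset.mem_range.mpr (by omega)) hn

end Specialization

/-! ## The quotient by the ideal -/

section Quotient

variable {n : ℕ} (P : NatUnitIntervalOrder n)

open Classical in
theorem sum_chains_eq_chainSum {A : Type*} [Ring A] (U : Fin n → A) (k r : ℕ) (hr : r ≤ n) :
    ∑ i : Fin k → Fin n with (List.ofFn i).IsChain (fun a b => P.lt b a) ∧
        ∀ y ∈ (List.ofFn i).head?, (y : ℕ) < r, wordEval U (List.ofFn i)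
      = chainSum P U k r := by
  induction k generalizing r with
  | zero => simp [chainSum, wordEval]
  | succ k ih =>
    have hrange : chainSum P U (k + 1) r
        = ∑ a : Fin n, if (a : ℕ) < r then U a * chainSum P U k (P.below a) else 0 := by
      have h1 : chainSum P U (k + 1) r = ∑ s ∈ Finset.range n,
          if s < r then extendZero U s * chainSum P U k (P.below s) else 0 := by
        rw [chainSum, ← Finset.sum_filter]
        congr 1
        ext s
        simp only [Finset.mem_range, Finset.mem_filter]
        omega
      rw [h1, Finset.sum_range]
      simp [extendZero]
    rw [hrange, Finset.sum_filter, ← (Fin.consEquiv fun _ => Fin n).sum_comp, Fintype.sum_prod_type]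
    refine Finset.sum_congr rfl fun a _ => ?_
    have hb : P.below a ≤ n := (P.below_le a).trans a.2.le
    rw [← ih _ hb, Finset.sum_filter, Finset.mul_sum]
    have hcons : ∀ i : Fin k → Fin n, List.ofFn ((Fin.consEquiv fun _ => Fin n) (a, i))
        = a :: List.ofFn i := fun i => List.ofFn_cons a i
    simp only [hcons, List.isChain_cons, List.head?_cons,
      Option.mem_some_iff, forall_eq', NatUnitIntervalOrder.lt_iff_below]
    split_ifs with har
    · refine Finset.sum_congr rfl fun i _ => ?_
      rw [mul_ite, mul_zero]
      refine if_congr (by tauto) ?_ rfl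
      simp [wordEval]
    · exact Finset.sum_eq_zero fun i _ => if_neg fun h => har h.2

namespace NatUnitIntervalOrder

/-- The quotient map by the ideal `I_P`. -/
noncomputable def quot : FreeAlgebra ℤ (Fin n) →+* P.ideal.ringCon.Quotient := P.ideal.ringCon.mk'

theorem quot_eq_zero_iff (z : FreeAlgebra ℤ (Fin n)) : P.quot z = 0 ↔ z ∈ P.ideal := by
  rw [← TwoSidedIdeal.mem_ker, quot, TwoSidedIdeal.ker_ringCon_mk']

/-- The generators of the quotient. -/
noncomputable def gen (a : Fin n) : P.ideal.ringCon.Quotient := P.quot (FreeAlgebra.ι ℤ a)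

theorem quot_wordMonomial (w : List (Fin n)) : P.quot (wordMonomial w) = wordEval P.gen w := by
  rw [wordMonomial, map_list_prod, List.map_map]
  rfl

theorem gen_comm (a c : Fin n) (h : P.lt a c) : P.gen a * P.gen c = P.gen c * P.gen a := by
  have : P.quot (wordMonomial [a, c] - wordMonomial [c, a]) = 0 :=
    (P.quot_eq_zero_iff _).mpr (TwoSidedIdeal.subset_span (Or.inl ⟨a, c, h, rfl⟩))
  rw [map_sub, quot_wordMonomial, quot_wordMonomial, sub_eq_zero] at this
  simpa [wordEval] using this

theorem gen_comm₃ (a b c : Fin n) (hab : a < b) (hbc : b < c) (hab' : ¬ P.lt a b)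
    (hbc' : ¬ P.lt b c) (hac : P.lt a c) :
    P.gen a * P.gen c * P.gen b = P.gen b * P.gen a * P.gen c := by
  have : P.quot (wordMonomial [a, c, b] - wordMonomial [b, a, c]) = 0 :=
    (P.quot_eq_zero_iff _).mpr
      (TwoSidedIdeal.subset_span (Or.inr ⟨a, b, c, hab, hbc, hab', hbc', hac, rfl⟩))
  rw [map_sub, quot_wordMonomial, quot_wordMonomial, sub_eq_zero] at this
  simpa [wordEval, mul_assoc] using this

theorem quot_elem (k : ℕ) : P.quot (P.elem k) = chainSum P P.gen k n := by
  classical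
  rw [← sum_chains_eq_chainSum P P.gen k n le_rfl, elem, map_sum]
  refine Finset.sum_congr ?_ fun i _ => P.quot_wordMonomial _
  ext i
  simp

theorem quot_elem_commute (i j : ℕ) : Commute (P.quot (P.elem i)) (P.quot (P.elem j)) := by
  rw [quot_elem, quot_elem]
  exact chainSum_commute P.gen_comm P.gen_comm₃ i j n

/-- The `P`-monomial symmetric functions indexed by partitions of length `k` add up to the words
without `P`-descents that have `k` sinks. -/
theorem sum_quot_monomial (d k : ℕ) :
    ∑ l : d.Partition with l.parts.card = k, P.quot (P.monomial l)
      = ∑ w ∈ P.normalWords d with P.sinkCount n w = k, wordEval P.gen w := by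
  classical
  have hlen : ∀ l : d.Partition, l.parts.card ≤ d := by
    intro l
    conv_rhs => rw [← l.parts_sum]
    simpa using Multiset.card_nsmul_le_sum (s := l.parts) (a := 1) fun x hx => l.parts_pos hx
  have hlen' : ∀ w ∈ P.normalWords d, P.sinkCount n w ≤ d := fun w hw =>
    (sinkCount_le_length n w).trans (mem_normalWords.mp hw).1.le
  rcases le_or_gt k d with hk | hk
  swap
  · rw [Finset.sum_eq_zero, Finset.sum_eq_zero]
    · intro w hw
      rw [Finset.mem_filter] at hw
      exact absurd (hlen' w hw.1) (by omega)
    · intro l hl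
      rw [Finset.mem_filter] at hl
      exact absurd (hlen l) (by omega)
  let H : ℕ → P.ideal.ringCon.Quotient := fun j => ∑ w ∈ P.normalWords j, wordEval P.gen w
  have hmul : ∀ i j, P.quot (P.elem i) * H j
      = ∑ w ∈ P.normalWords (i + j), (P.sinkCount n w).choose i • wordEval P.gen w := by
    intro i j
    rw [quot_elem]
    exact chainSum_mul_normalWords P.gen_comm n le_rfl i j
  have hH : ∀ m, m ≠ 0 →
      ∑ i ∈ Finset.range (m + 1), (-1 : ℤ) ^ i • (P.quot (P.elem i) * H (m - i)) = 0 := by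
    intro m hm
    have h1 : ∀ i ∈ Finset.range (m + 1), (-1 : ℤ) ^ i • (P.quot (P.elem i) * H (m - i))
        = ∑ w ∈ P.normalWords m,
          ((-1 : ℤ) ^ i * ((P.sinkCount n w).choose i : ℤ)) • wordEval P.gen w := by
      intro i hi
      rw [hmul, Nat.add_sub_cancel' (Nat.lt_succ_iff.mp (Finset.mem_range.mp hi)), Finset.smul_sum]
      refine Finset.sum_congr rfl fun w _ => ?_
      rw [mul_smul, natCast_zsmul]
    rw [Finset.sum_congr rfl h1, Finset.sum_comm]
    refine Finset.sum_eq_zero fun w hw => ?_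
    rw [← Finset.sum_smul]
    rw [mem_normalWords] at hw
    have hc : P.sinkCount n w ≤ m := (sinkCount_le_length n w).trans hw.1.le
    have h0 : P.sinkCount n w ≠ 0 := (sinkCount_pos (by rintro rfl; exact hm hw.1.symm)).ne'
    rw [← Finset.sum_subset (Finset.range_subset_range.mpr (Nat.succ_le_succ hc)),
      Int.alternating_sum_range_choose, if_neg h0, zero_smul]
    intro i _ hi
    rw [Nat.choose_eq_zero_of_lt (by simpa using hi)]
    simp
  have he₀ : P.quot (P.elem 0) = 1 := by rw [quot_elem, chainSum]
  have hH₀ : H 0 = 1 := by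
    have : P.normalWords 0 = {[]} := by
      ext w
      rw [mem_normalWords, Finset.mem_singleton, List.length_eq_zero_iff]
      refine ⟨fun h => h.1, ?_⟩
      rintro rfl
      exact ⟨rfl, List.isChain_nil⟩
    simp [H, this, wordEval]
  have hmono : ∀ l : d.Partition, P.quot (P.monomial l) = ∑ ν : d.Partition,
      monoToElem l ν • ((ν.parts.sort (· ≥ ·)).map fun k => P.quot (P.elem k)).prod := by
    intro l
    rw [monomial, map_sum]
    refine Finset.sum_congr rfl fun ν _ => ?_
    rw [map_zsmul, elemPart, map_list_prod, List.map_map]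
    rfl
  have main : ∀ i ≤ d, ∑ l : d.Partition, l.parts.card.choose i • P.quot (P.monomial l)
      = ∑ w ∈ P.normalWords d, (P.sinkCount n w).choose i • wordEval P.gen w := by
    intro i hi
    simp only [hmono]
    rw [sum_choose_monomial (fun k => P.quot (P.elem k)) H he₀ hH₀ P.quot_elem_commute hH hi, hmul,
      Nat.add_sub_cancel' hi]
  refine sub_eq_zero.mp (eq_of_sum_choose_eq d (fun k =>
    ∑ l : d.Partition with l.parts.card = k, P.quot (P.monomial l)
      - ∑ w ∈ P.normalWords d with P.sinkCount n w = k, wordEval P.gen w) (fun i hi => ?_) k hk)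
  have h1 : ∑ l : d.Partition, l.parts.card.choose i • P.quot (P.monomial l)
      = ∑ k ∈ Finset.range (d + 1), k.choose i •
        ∑ l : d.Partition with l.parts.card = k, P.quot (P.monomial l) := by
    rw [← Finset.sum_fiberwise_of_maps_to (s := Finset.univ) (t := Finset.range (d + 1))
      (g := fun l : d.Partition => l.parts.card)
      fun l _ => Finset.mem_range.mpr (Nat.lt_succ_of_le (hlen l))]
    refine Finset.sum_congr rfl fun k _ => ?_
    rw [Finset.smul_sum]
    refine Finset.sum_congr rfl fun l hl => ?_
    rw [(Finset.mem_filter.mp hl).2]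
  have h2 : ∑ w ∈ P.normalWords d, (P.sinkCount n w).choose i • wordEval P.gen w
      = ∑ k ∈ Finset.range (d + 1), k.choose i •
        ∑ w ∈ P.normalWords d with P.sinkCount n w = k, wordEval P.gen w := by
    rw [← Finset.sum_fiberwise_of_maps_to (t := Finset.range (d + 1))
      (g := fun w => P.sinkCount n w)
      fun w hw => Finset.mem_range.mpr (Nat.lt_succ_of_le (hlen' w hw))]
    refine Finset.sum_congr rfl fun k _ => ?_
    rw [Finset.smul_sum]
    refine Finset.sum_congr rfl fun w hw => ?_
    rw [(Finset.mem_filter.mp hw).2]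
  simp only [smul_sub]
  rw [Finset.sum_sub_distrib, ← h1, ← h2, main i hi, sub_self]

end NatUnitIntervalOrder

end Quotient

/-! ## Heaps and words -/

section HeapWords

variable {n : ℕ} {P : NatUnitIntervalOrder n} {μ : Fin n → ℕ}

theorem card_filter_get_eq {α : Type*} [DecidableEq α] (w : List α) (a : α) :
    (Finset.univ.filter fun k : Fin w.length => w.get k = a).card = w.count a := by
  have h : (Finset.univ : Finset (Fin w.length)).val.map w.get = (w : Multiset α) := by
    simp [Fin.univ_val_map]
  rw [← Multiset.coe_count, ← h, Multiset.count_map, Finset.card_def, Finset.filter_val]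
  simp only [eq_comm]

theorem sum_count_eq_length {α : Type*} [Fintype α] [DecidableEq α] (w : List α) :
    ∑ a, w.count a = w.length := by
  simpa using Multiset.sum_count_eq_card (m := (w : Multiset α)) fun a _ => Finset.mem_univ a

/-- A listing of the blocks by the positions of a word, in which blocks of the same column are
listed in increasing order. -/
def IsLabelling (w : List (Fin n)) (f : Fin w.length ≃ Block μ) : Prop :=
  (∀ k, w.get k = (f k).1) ∧
    ∀ (a : Fin n) (i j : Fin (μ a)), i < j → f.symm ⟨a, i⟩ < f.symm ⟨a, j⟩

theorem exists_labelling {w : List (Fin n)} (hw : ∀ a, w.count a = μ a) :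
    ∃ f : Fin w.length ≃ Block μ, IsLabelling w f := by
  have hS : ∀ a, (Finset.univ.filter fun k : Fin w.length => w.get k = a).card = μ a :=
    fun a => (card_filter_get_eq w a).trans (hw a)
  let g : Block μ → Fin w.length := fun p => Finset.orderEmbOfFin _ (hS p.1) p.2
  have hg : ∀ p, w.get (g p) = p.1 := fun p =>
    (Finset.mem_filter.mp (Finset.orderEmbOfFin_mem _ (hS p.1) p.2)).2
  have hinj : Function.Injective g := by
    rintro ⟨a, i⟩ ⟨b, j⟩ h
    obtain rfl : a = b := (hg ⟨a, i⟩).symm.trans ((congrArg w.get h).trans (hg ⟨b, j⟩))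
    exact congrArg _ ((Finset.orderEmbOfFin _ (hS a)).injective h)
  have hsurj : Function.Surjective g := by
    intro k
    have hk : k ∈ Set.range (Finset.orderEmbOfFin _ (hS (w.get k))) := by
      rw [Finset.range_orderEmbOfFin]
      simp
    obtain ⟨i, hi⟩ := hk
    exact ⟨⟨w.get k, i⟩, hi⟩
  refine ⟨(Equiv.ofBijective g ⟨hinj, hsurj⟩).symm, fun k => ?_, fun a i j hij => ?_⟩
  · rw [← hg, ← Equiv.ofBijective_apply g ⟨hinj, hsurj⟩, Equiv.apply_symm_apply]
  · exact (Finset.orderEmbOfFin _ (hS a)).strictMono hij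

theorem IsLabelling.count {w : List (Fin n)} {f : Fin w.length ≃ Block μ} (hf : IsLabelling w f)
    (a : Fin n) : w.count a = μ a := by
  rw [← card_filter_get_eq]
  refine (Finset.card_bij' (t := (Finset.univ : Finset (Fin (μ a))).map
    (Function.Embedding.sigmaMk (β := fun a => Fin (μ a)) a)) (fun k _ => f k) (fun p _ => f.symm p)
    ?_ ?_ ?_ ?_).trans (by simp)
  · intro k hk
    have h := (hf.1 k).symm.trans (Finset.mem_filter.mp hk).2
    rw [Finset.mem_map]
    exact ⟨h ▸ (f k).2, Finset.mem_univ _, by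
      generalize f k = p at h
      obtain ⟨b, j⟩ := p
      obtain rfl : b = a := h
      rfl⟩
  · intro p hp
    obtain ⟨i, _, rfl⟩ := Finset.mem_map.mp hp
    rw [Finset.mem_filter, hf.1, Equiv.apply_symm_apply]
    exact ⟨Finset.mem_univ _, rfl⟩
  · simp
  · simp

theorem IsLabelling.unique {w : List (Fin n)} {f f' : Fin w.length ≃ Block μ}
    (hf : IsLabelling w f) (hf' : IsLabelling w f') : f = f' := by
  have hS : ∀ a, (Finset.univ.filter fun k : Fin w.length => w.get k = a).card = μ a :=
    fun a => (card_filter_get_eq w a).trans (hf.count a)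
  have key : ∀ {f : Fin w.length ≃ Block μ}, IsLabelling w f → ∀ a,
      (fun i : Fin (μ a) => f.symm ⟨a, i⟩) = Finset.orderEmbOfFin _ (hS a) := by
    intro f hf a
    refine Finset.orderEmbOfFin_unique (hS a) (fun i => ?_) fun i j hij => hf.2 a i j hij
    rw [Finset.mem_filter, hf.1, Equiv.apply_symm_apply]
    exact ⟨Finset.mem_univ _, rfl⟩
  have : f.symm = f'.symm := by
    ext ⟨a, i⟩ : 1
    exact congrFun ((key hf a).trans (key hf' a).symm) i
  rw [← f.symm_symm, this, f'.symm_symm]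

namespace Heap

theorem exists_labelling_of_isWord {H : Heap P μ} {w : List (Fin n)} (hw : H.IsWord w) :
    ∃ f : Fin w.length ≃ Block μ, IsLabelling w f ∧
      ∀ p q, H.arrow p q ↔ blockAdj P μ p q ∧ f.symm q < f.symm p := by
  obtain ⟨f, hf, hfw⟩ := hw
  have harrow : ∀ p q, H.arrow p q → f.symm q < f.symm p := fun p q h =>
    hf _ _ (by simpa using h)
  refine ⟨f, ⟨hfw, fun a i j hij => harrow _ _ (H.column a i j hij)⟩, fun p q => ⟨fun h =>
    ⟨(H.adj_iff p q).mpr (Or.inl h), harrow p q h⟩, fun h => ?_⟩⟩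
  rcases (H.adj_iff p q).mp h.1 with h' | h'
  · exact h'
  · exact absurd (harrow q p h') (not_lt.mpr h.2.le)

theorem word_spec (H : Heap P μ) : H.IsWord H.word ∧ NoPDescents P H.word :=
  H.existsUnique_word.choose_spec.1

theorem word_eq_of_isWord {H : Heap P μ} {w : List (Fin n)} (hw : H.IsWord w)
    (hw' : NoPDescents P w) : H.word = w :=
  H.existsUnique_word.unique H.word_spec ⟨hw, hw'⟩

theorem count_word (H : Heap P μ) (a : Fin n) : H.word.count a = μ a := by
  obtain ⟨f, hf, -⟩ := exists_labelling_of_isWord H.word_spec.1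
  exact hf.count a

theorem word_injective : Function.Injective (word : Heap P μ → List (Fin n)) := by
  intro H H' h
  obtain ⟨f, hf, hfa⟩ := exists_labelling_of_isWord H.word_spec.1
  have h2 := H'.word_spec.1
  rw [← h] at h2
  obtain ⟨f', hf', hfa'⟩ := exists_labelling_of_isWord h2
  obtain rfl := hf.unique hf'
  ext p q
  rw [hfa, hfa']

theorem exists_word_eq {w : List (Fin n)} (hw : ∀ a, w.count a = μ a) (hw' : NoPDescents P w) :
    ∃ H : Heap P μ, H.word = w := by
  obtain ⟨f, hf⟩ := exists_labelling hw
  have hsymm : ∀ p q, blockAdj P μ p q → blockAdj P μ q p := fun p q h =>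
    ⟨h.1.symm, h.2.imp Eq.symm fun h => h.symm⟩
  let H : Heap P μ :=
    { arrow := fun p q => blockAdj P μ p q ∧ f.symm q < f.symm p
      adj_iff := by
        intro p q
        constructor
        · intro h
          rcases lt_trichotomy (f.symm p) (f.symm q) with h1 | h1 | h1
          · exact Or.inr ⟨hsymm _ _ h, h1⟩
          · exact absurd (f.symm.injective h1) h.1
          · exact Or.inl ⟨h, h1⟩
        · rintro (h | h)
          · exact h.1
          · exact hsymm _ _ h.1
      asymm := fun p q h h' => absurd h.2 (not_lt.mpr h'.2.le)
      acyclic := by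
        have : ∀ p q, Relation.TransGen (fun p q => blockAdj P μ p q ∧ f.symm q < f.symm p) p q →
            f.symm q < f.symm p := by
          intro p q h
          induction h with
          | single h => exact h.2
          | tail _ h ih => exact h.2.trans ih
        exact fun p h => (this p p h).false
      column := by
        intro a i j hij
        refine ⟨⟨?_, Or.inl rfl⟩, hf.2 a i j hij⟩
        intro h
        exact hij.ne' (sigma_mk_injective (β := fun a => Fin (μ a)) h) }
  refine ⟨H, word_eq_of_isWord ⟨f, fun j k h => ?_, hf.1⟩ hw'⟩
  simpa using h.2

end Heap

namespace NatUnitIntervalOrder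

theorem isSinkLetter_iff (a : Fin n) (w : List (Fin n)) :
    P.IsSinkLetter a w ↔ ∃ k : Fin w.length, w.get k = a ∧
      ∀ j < k, P.lt a (w.get j) ∨ P.lt (w.get j) a := by
  induction w with
  | nil => exact ⟨False.elim, fun ⟨k, _⟩ => k.elim0⟩
  | cons b w ih =>
    rw [IsSinkLetter, ih]
    refine Iff.trans ?_ (Fin.exists_fin_succ (n := w.length)).symm
    refine or_congr ?_ ?_
    · constructor
      · rintro rfl
        exact ⟨rfl, fun j hj => absurd hj (Fin.not_lt_zero j)⟩
      · rintro ⟨h, _⟩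
        exact h.symm
    · constructor
      · rintro ⟨h, k, hk, hk'⟩
        refine ⟨k, hk, fun j hj => ?_⟩
        cases j using Fin.cases with
        | zero => exact h
        | succ j => exact hk' j (Fin.succ_lt_succ_iff.mp hj)
      · rintro ⟨k, hk, hk'⟩
        exact ⟨hk' 0 (Fin.succ_pos k), k, hk, fun j hj => hk' j.succ (Fin.succ_lt_succ_iff.mpr hj)⟩

variable (P) in
open Classical in
/-- The number of letters of `w` that are smaller than and incomparable to `a`. -/
noncomputable def cross (a : Fin n) (w : List (Fin n)) : ℕ :=
  w.countP fun b => b < a ∧ P.inc.Adj a b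

variable (P) in
/-- The number of inversions between incomparable letters. -/
noncomputable def inversions : List (Fin n) → ℕ
  | [] => 0
  | a :: w => P.cross a w + inversions w

open Classical in
theorem cross_eq_sum (a : Fin n) (w : List (Fin n)) :
    P.cross a w = ∑ k : Fin w.length, if w.get k < a ∧ P.inc.Adj a (w.get k) then 1 else 0 := by
  induction w with
  | nil => rfl
  | cons b w ih =>
    rw [cross] at ih
    refine Eq.trans ?_ (Fin.sum_univ_succ (n := w.length) _).symm
    rw [cross, List.countP_cons, ih, add_comm]
    simp only [decide_eq_true_eq]
    congr 1

open Classical in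
theorem inversions_eq_sum (w : List (Fin n)) :
    P.inversions w = ∑ j : Fin w.length, ∑ k : Fin w.length,
      if j < k ∧ w.get k < w.get j ∧ P.inc.Adj (w.get j) (w.get k) then 1 else 0 := by
  induction w with
  | nil => rfl
  | cons b w ih =>
    refine Eq.trans ?_ (Fin.sum_univ_succ (n := w.length) _).symm
    rw [inversions, ih, cross_eq_sum]
    congr 1
    · refine Eq.trans ?_ (Fin.sum_univ_succ (n := w.length) _).symm
      simp
    · refine Finset.sum_congr rfl fun j _ => ?_
      refine Eq.trans ?_ (Fin.sum_univ_succ (n := w.length) _).symm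
      simp

end NatUnitIntervalOrder

namespace Heap

theorem not_blockAdj_iff {p q : Block μ} (h : p ≠ q) :
    ¬ blockAdj P μ p q ↔ P.lt p.1 q.1 ∨ P.lt q.1 p.1 := by
  simp only [blockAdj, NatUnitIntervalOrder.inc]
  constructor
  · tauto
  · rintro (h' | h') ⟨_, (h2 | h2)⟩
    · exact P.lt_irrefl _ (h2 ▸ h')
    · exact h2.2.1 h'
    · exact P.lt_irrefl _ (h2 ▸ h')
    · exact h2.2.2 h'

theorem numSinks_eq (H : Heap P μ) : H.numSinks = P.sinkCount n H.word := by
  classical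
  obtain ⟨f, hf, hfa⟩ := exists_labelling_of_isWord H.word_spec.1
  have hsink : ∀ k, H.IsSink (f k) ↔ ∀ j < k, P.lt (H.word.get k) (H.word.get j) ∨
      P.lt (H.word.get j) (H.word.get k) := by
    intro k
    rw [IsSink, f.surjective.forall]
    refine forall_congr' fun j => ?_
    rw [hfa, hf.1, hf.1, f.symm_apply_apply, f.symm_apply_apply, not_and']
    refine imp_congr_right fun hjk => ?_
    exact not_blockAdj_iff fun h => hjk.ne' (f.injective h)
  refine Finset.card_bij (fun p _ => p.1) ?_ ?_ ?_
  · intro p hp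
    obtain ⟨k, rfl⟩ := f.surjective p
    rw [Set.mem_toFinset] at hp ⊢
    exact ⟨(f k).1.2, (NatUnitIntervalOrder.isSinkLetter_iff _ _).mpr
      ⟨k, hf.1 k, by rw [← hf.1]; exact (hsink k).mp hp⟩⟩
  · rintro ⟨a, i⟩ hp ⟨b, j⟩ hq h
    obtain rfl : a = b := h
    rw [Set.mem_toFinset] at hp hq
    rcases lt_trichotomy i j with h | rfl | h
    · exact absurd (H.column a i j h) (hq _)
    · rfl
    · exact absurd (H.column a j i h) (hp _)
  · intro a ha
    rw [Set.mem_toFinset] at ha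
    obtain ⟨k, rfl, hk⟩ := (NatUnitIntervalOrder.isSinkLetter_iff _ _).mp ha.2
    exact ⟨f k, by rw [Set.mem_toFinset]; exact (hsink k).mpr hk, (hf.1 k).symm⟩

theorem asc_eq (H : Heap P μ) : H.asc = P.inversions H.word := by
  classical
  obtain ⟨f, hf, hfa⟩ := exists_labelling_of_isWord H.word_spec.1
  rw [NatUnitIntervalOrder.inversions_eq_sum, Finset.sum_comm, ← Finset.sum_product',
    ← Finset.card_filter]
  refine Finset.card_bij' (fun e _ => (f.symm e.1, f.symm e.2)) (fun e _ => (f e.1, f e.2))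
    ?_ ?_ (by simp) (by simp)
  · rintro ⟨p, q⟩ h
    rw [Set.mem_toFinset] at h
    obtain ⟨h1, h2⟩ := h
    have h1 := (hfa p q).mp h1
    simp only [Finset.mem_filter, hf.1, Equiv.apply_symm_apply]
    refine ⟨Finset.mem_univ _, h1.2, h2, ?_⟩
    exact (h1.1.2.resolve_left h2.ne).symm
  · rintro ⟨j, k⟩ h
    simp only [Finset.mem_filter, hf.1] at h
    rw [Set.mem_toFinset]
    refine ⟨(hfa _ _).mpr ⟨⟨?_, Or.inr h.2.2.2.symm⟩, by simpa using h.2.1⟩, h.2.2.1⟩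
    intro h'
    exact h.2.1.ne' (f.injective h')

open Classical in
/-- Sums over heaps are sums over words without `P`-descents. -/
theorem sum_heaps {M : Type*} [AddCommMonoid M] (d k : ℕ) (hd : ∑ a, μ a = d)
    (F : List (Fin n) → M) :
    ∑ H : Heap P μ with H.numSinks = k, F H.word
      = ∑ w ∈ P.normalWords d with P.sinkCount n w = k ∧ ∀ a, w.count a = μ a, F w := by
  refine Finset.sum_bij (fun H _ => H.word) ?_ ?_ ?_ ?_
  · intro H hH
    rw [Finset.mem_filter] at hH
    rw [Finset.mem_filter, NatUnitIntervalOrder.mem_normalWords, ← H.numSinks_eq]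
    refine ⟨⟨?_, H.word_spec.2⟩, hH.2, H.count_word⟩
    rw [← hd, ← sum_count_eq_length]
    exact Finset.sum_congr rfl fun a _ => H.count_word a
  · intro H _ H' _ h
    exact word_injective h
  · intro w hw
    rw [Finset.mem_filter, NatUnitIntervalOrder.mem_normalWords] at hw
    obtain ⟨H, rfl⟩ := exists_word_eq hw.2.2 hw.1.2
    refine ⟨H, ?_, rfl⟩
    rw [Finset.mem_filter, H.numSinks_eq]
    exact ⟨Finset.mem_univ _, hw.2.1⟩
  · intro _ _
    rfl

end Heap

end HeapWords

/-! ## The functional that counts inversions -/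

section Functional

variable {n : ℕ} (P : NatUnitIntervalOrder n)

theorem basisFreeMonoid_apply (w : List (Fin n)) :
    FreeAlgebra.basisFreeMonoid ℤ (Fin n) (FreeMonoid.ofList w) = wordMonomial w := by
  simp [FreeAlgebra.basisFreeMonoid, FreeAlgebra.equivMonoidAlgebraFreeMonoid, wordMonomial,
    FreeMonoid.lift_apply]
  exact one_smul ℤ (_ : FreeAlgebra ℤ (Fin n))

namespace NatUnitIntervalOrder

theorem cross_append (a : Fin n) (w w' : List (Fin n)) :
    P.cross a (w ++ w') = P.cross a w + P.cross a w' := List.countP_append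

theorem cross_perm (a : Fin n) {w w' : List (Fin n)} (h : w.Perm w') :
    P.cross a w = P.cross a w' := h.countP_eq _

theorem inversions_append (w w' : List (Fin n)) :
    P.inversions (w ++ w')
      = P.inversions w + (w.map fun a => P.cross a w').sum + P.inversions w' := by
  induction w with
  | nil => simp [inversions]
  | cons a w ih =>
    rw [List.cons_append, inversions, cross_append, ih, inversions, List.map_cons, List.sum_cons]
    omega

theorem inversions_append_append (w r r' w' : List (Fin n)) (hp : r.Perm r')
    (hi : P.inversions r = P.inversions r') :
    P.inversions (w ++ r ++ w') = P.inversions (w ++ r' ++ w') := by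
  simp only [inversions_append, List.map_append, List.sum_append, hi,
    (hp.map fun a => P.cross a w').sum_eq, fun a => P.cross_perm a hp]

open Classical in
/-- The linear functional with `u_w ↦ q^{inv(w)}` if the letter `a` appears `μ a` times in `w`, for
all `a`, and `u_w ↦ 0` otherwise. -/
noncomputable def invFunctional (μ : Fin n → ℕ) : FreeAlgebra ℤ (Fin n) →+ Polynomial ℚ :=
  LinearMap.toAddMonoidHom <| (FreeAlgebra.basisFreeMonoid ℤ (Fin n)).constr ℤ fun w =>
    if ∀ a, w.toList.count a = μ a then Polynomial.X ^ P.inversions w.toList else 0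

open Classical in
theorem invFunctional_wordMonomial (μ : Fin n → ℕ) (w : List (Fin n)) :
    P.invFunctional μ (wordMonomial w)
      = if ∀ a, w.count a = μ a then Polynomial.X ^ P.inversions w else 0 := by
  rw [← basisFreeMonoid_apply]
  exact (FreeAlgebra.basisFreeMonoid ℤ (Fin n)).constr_basis ℤ _ _

theorem wordMonomial_append (w w' : List (Fin n)) :
    wordMonomial (w ++ w') = wordMonomial w * wordMonomial w' := by
  simp [wordMonomial]

theorem mem_closure_wordMonomial (z : FreeAlgebra ℤ (Fin n)) :
    z ∈ AddSubgroup.closure (Set.range (wordMonomial (n := n))) := by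
  induction (FreeAlgebra.basisFreeMonoid ℤ (Fin n)).mem_span z using Submodule.span_induction with
  | zero => exact zero_mem _
  | add x y _ _ hx hy => exact add_mem hx hy
  | smul c x _ hx =>
    have := zsmul_mem hx c
    rwa [zsmul_eq_mul, ← eq_intCast (algebraMap ℤ (FreeAlgebra ℤ (Fin n))), ← Algebra.smul_def]
      at this
  | mem x hx =>
    obtain ⟨w, rfl⟩ := hx
    exact AddSubgroup.subset_closure ⟨w.toList, (basisFreeMonoid_apply _).symm⟩

theorem inversions_pair_comm {a c : Fin n} (h : P.lt a c) :
    P.inversions [a, c] = P.inversions [c, a] := by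
  have h1 : ¬ P.inc.Adj a c := fun h' => h'.2.1 h
  have h2 : ¬ P.inc.Adj c a := fun h' => h'.2.2 h
  simp [inversions, cross, h1, h2]

theorem inversions_triple_comm {a b c : Fin n} (hab : a < b) (hbc : b < c) (hab' : ¬ P.lt a b)
    (hbc' : ¬ P.lt b c) (hac : P.lt a c) : P.inversions [a, c, b] = P.inversions [b, a, c] := by
  have h1 : ¬ P.inc.Adj a c := fun h' => h'.2.1 hac
  have h2 : P.inc.Adj c b := ⟨hbc.ne', fun h => absurd (lt_imp_lt h) (not_lt.mpr hbc.le), hbc'⟩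
  have h3 : P.inc.Adj b a := ⟨hab.ne', fun h => absurd (lt_imp_lt h) (not_lt.mpr hab.le), hab'⟩
  simp [inversions, cross, h1, h2, h3, hab, hbc, not_lt.mpr hab.le, not_lt.mpr hbc.le]

theorem invFunctional_eq_zero (μ : Fin n → ℕ) {z : FreeAlgebra ℤ (Fin n)} (hz : z ∈ P.ideal) :
    P.invFunctional μ z = 0 := by
  classical
  let I : TwoSidedIdeal (FreeAlgebra ℤ (Fin n)) := TwoSidedIdeal.mk'
    {z | ∀ x y, P.invFunctional μ (x * z * y) = 0}
    (by intro x y; simp)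
    (by
      intro z z' hz hz' x y
      rw [mul_add, add_mul, map_add, hz, hz', add_zero])
    (by
      intro z hz x y
      rw [mul_neg, neg_mul, map_neg, hz, neg_zero])
    (by
      intro z z' hz' x y
      rw [← mul_assoc]
      exact hz' (x * z) y)
    (by
      intro z z' hz x y
      rw [← mul_assoc, mul_assoc _ z' y]
      exact hz x (z' * y))
  have hgen : ∀ r r' : List (Fin n), r.Perm r' → P.inversions r = P.inversions r' →
      wordMonomial r - wordMonomial r' ∈ I := by
    intro r r' hp hi
    refine (TwoSidedIdeal.mem_mk' ..).mpr fun x y => ?_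
    induction mem_closure_wordMonomial x using AddSubgroup.closure_induction with
    | zero => simp
    | add x x' _ _ hx hx' => rw [add_mul, add_mul, map_add, hx, hx', add_zero]
    | neg x _ hx => rw [neg_mul, neg_mul, map_neg, hx, neg_zero]
    | mem x hx =>
      obtain ⟨w, rfl⟩ := hx
      induction mem_closure_wordMonomial y using AddSubgroup.closure_induction with
      | zero => simp
      | add y y' _ _ hy hy' => rw [mul_add, map_add, hy, hy', add_zero]
      | neg y _ hy => rw [mul_neg, map_neg, hy, neg_zero]
      | mem y hy =>
        obtain ⟨w', rfl⟩ := hy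
        rw [mul_sub, sub_mul, map_sub, sub_eq_zero, ← wordMonomial_append, ← wordMonomial_append,
          ← wordMonomial_append, ← wordMonomial_append, invFunctional_wordMonomial,
          invFunctional_wordMonomial, P.inversions_append_append w r r' w' hp hi]
        refine if_congr (forall_congr' fun a => ?_) rfl rfl
        rw [List.count_append, List.count_append, List.count_append, List.count_append, hp.count_eq]
  have hle : P.ideal ≤ I := by
    refine TwoSidedIdeal.span_le.mpr ?_
    rintro z (⟨a, c, hac, rfl⟩ | ⟨a, b, c, hab, hbc, hab', hbc', hac, rfl⟩)
    · exact hgen _ _ (.swap _ _ _) (P.inversions_pair_comm hac)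
    · refine hgen _ _ ?_ (P.inversions_triple_comm hab hbc hab' hbc' hac)
      exact (List.Perm.cons a (.swap _ _ _)).trans (.swap _ _ _)
  have := (TwoSidedIdeal.mem_mk' ..).mp (hle hz) 1 1
  simpa using this

theorem invFunctional_congr (μ : Fin n → ℕ) {z z' : FreeAlgebra ℤ (Fin n)}
    (h : P.quot z = P.quot z') : P.invFunctional μ z = P.invFunctional μ z' := by
  rw [← sub_eq_zero, ← map_sub]
  refine P.invFunctional_eq_zero μ ((P.quot_eq_zero_iff _).mp ?_)
  rw [map_sub, h, sub_self]

end NatUnitIntervalOrder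

end Functional

/-! ## The coefficients of the chromatic quasisymmetric function -/

section ChromaticCoefficients

variable {n : ℕ} (P : NatUnitIntervalOrder n)

theorem list_prod_ofFn_sum {A β : Type*} [Semiring A] {m : ℕ} (S : Fin m → Finset β)
    (f : Fin m → β → A) :
    (List.ofFn fun i => ∑ b ∈ S i, f i b).prod
      = ∑ b ∈ Fintype.piFinset S, (List.ofFn fun i => f i (b i)).prod := by
  classical
  induction m with
  | zero => simp
  | succ m ih =>
    rw [List.ofFn_succ, List.prod_cons, ih (fun i => S i.succ), Finset.sum_mul_sum,
      ← Finset.sum_product']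
    refine Finset.sum_bij' (fun b _ => (Fin.cons b.1 b.2 : Fin (m + 1) → β))
      (fun b _ => (b 0, Fin.tail b)) ?_ ?_ ?_ ?_ ?_
    · rintro ⟨a, b⟩ h
      rw [Finset.mem_product, Fintype.mem_piFinset] at h
      rw [Fintype.mem_piFinset]
      intro i
      cases i using Fin.cases with
      | zero => exact h.1
      | succ i => exact h.2 i
    · intro b h
      rw [Fintype.mem_piFinset] at h
      rw [Finset.mem_product, Fintype.mem_piFinset]
      exact ⟨h 0, fun i => h i.succ⟩
    · rintro ⟨a, b⟩ _
      simp
    · intro b _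
      simp
    · rintro ⟨a, b⟩ _
      simp [List.ofFn_succ]

theorem map_sort_sum {α M : Type*} [LinearOrder α] [AddCommMonoid M] (C : Finset α) (f : α → M) :
    ((C.sort (· ≥ ·)).map f).sum = ∑ a ∈ C, f a := by
  rw [Finset.sum_eq_multiset_sum, ← Finset.sort_eq C (· ≥ ·), Multiset.map_coe, Multiset.sum_coe]

namespace NatUnitIntervalOrder

open Classical in
/-- The chains of cardinality `k` of `P`. -/
noncomputable def chains (k : ℕ) : Finset (Finset (Fin n)) :=
  {C ∈ Finset.univ.powersetCard k | ∀ a ∈ C, ∀ b ∈ C, ¬ P.inc.Adj a b}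

theorem mem_chains {k : ℕ} {C : Finset (Fin n)} :
    C ∈ P.chains k ↔ C.card = k ∧ ∀ a ∈ C, ∀ b ∈ C, ¬ P.inc.Adj a b := by
  classical
  rw [chains, Finset.mem_filter, Finset.mem_powersetCard_univ]

theorem elem_eq_sum_chains (k : ℕ) :
    P.elem k = ∑ C ∈ P.chains k, wordMonomial (C.sort (· ≥ ·)) := by
  classical
  have htrans : IsTrans (Fin n) fun a b => P.lt b a := ⟨fun _ _ _ h h' => lt_trans h' h⟩
  have hsort : ∀ l : List (Fin n), l.IsChain (fun a b => P.lt b a) →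
      l.Nodup ∧ l.toFinset.sort (· ≥ ·) = l := by
    intro l hl
    have h1 := List.isChain_iff_pairwise.mp hl
    have h2 : l.Nodup := h1.imp fun h => (lt_imp_lt h).ne'
    exact ⟨h2, (List.toFinset_sort _ h2).mpr (h1.imp fun h => (lt_imp_lt h).le)⟩
  rw [elem]
  refine Finset.sum_bij (fun i _ => (List.ofFn i).toFinset) ?_ ?_ ?_ ?_
  · intro i hi
    rw [Finset.mem_filter] at hi
    rw [mem_chains]
    have h1 := List.isChain_iff_pairwise.mp hi.2
    refine ⟨?_, ?_⟩
    · rw [List.toFinset_card_of_nodup (hsort _ hi.2).1, List.length_ofFn]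
    · intro a ha b hb hab
      rw [List.mem_toFinset] at ha hb
      have h2 := List.Pairwise.forall_of_forall_of_flip (R := fun a b => ¬ P.inc.Adj a b)
        (l := List.ofFn i) (fun x _ h => P.inc.loopless.irrefl x h)
        (h1.imp fun h h' => h'.2.2 h) (h1.imp fun h h' => h'.2.1 h)
      exact h2 ha hb hab
  · intro i hi j hj h
    rw [Finset.mem_filter] at hi hj
    refine List.ofFn_injective ?_
    rw [← (hsort _ hi.2).2, h, (hsort _ hj.2).2]
  · intro C hC
    rw [mem_chains] at hC
    obtain ⟨i, hi⟩ : ∃ i : Fin k → Fin n, List.ofFn i = C.sort (· ≥ ·) := by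
      have hl : (C.sort (· ≥ ·)).length = k := (Finset.length_sort _).trans hC.1
      subst hl
      exact ⟨_, List.ofFn_get _⟩
    refine ⟨i, ?_, ?_⟩
    · rw [Finset.mem_filter, hi, List.isChain_iff_pairwise]
      refine ⟨Finset.mem_univ _, ?_⟩
      have h1 := (Finset.pairwise_sort C (· ≥ ·)).and (Finset.sort_nodup C (· ≥ ·))
      refine h1.imp_of_mem fun {a b} ha hb h => ?_
      rw [Finset.mem_sort] at ha hb
      have h2 := hC.2 a ha b hb
      by_contra h3
      refine h2 ⟨h.2, fun h4 => ?_, h3⟩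
      exact absurd (lt_imp_lt h4) (not_lt.mpr h.1)
    · rw [hi, Finset.sort_toFinset]
  · intro i hi
    rw [Finset.mem_filter] at hi
    rw [(hsort _ hi.2).2]

/-- The word that lists the elements of the chains `K 0, K 1, …`, each in decreasing order. -/
noncomputable def chainWord {m : ℕ} (K : Fin m → Finset (Fin n)) : List (Fin n) :=
  (List.ofFn fun i => (K i).sort (· ≥ ·)).flatten

theorem wordMonomial_flatten (L : List (List (Fin n))) :
    wordMonomial L.flatten = (L.map wordMonomial).prod := by
  induction L with
  | nil => simp [wordMonomial]
  | cons w L ih => rw [List.flatten_cons, wordMonomial_append, ih, List.map_cons, List.prod_cons]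

theorem prod_elem_eq_sum {m : ℕ} (s : Fin m → ℕ) :
    (List.ofFn fun i => P.elem (s i)).prod
      = ∑ K ∈ Fintype.piFinset fun i => P.chains (s i), wordMonomial (chainWord K) := by
  simp only [elem_eq_sum_chains]
  rw [list_prod_ofFn_sum]
  refine Finset.sum_congr rfl fun K _ => ?_
  rw [chainWord, wordMonomial_flatten, List.map_ofFn]
  rfl

theorem count_chainWord {m : ℕ} (K : Fin m → Finset (Fin n)) (a : Fin n) :
    (chainWord K).count a = (Finset.univ.filter fun i => a ∈ K i).card := by
  rw [chainWord, List.count_flatten, List.map_ofFn, List.sum_ofFn, Finset.card_filter]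
  refine Finset.sum_congr rfl fun i _ => ?_
  rw [Function.comp_apply, ← Multiset.coe_count, Finset.sort_eq, Multiset.count_eq_of_nodup (K i).2]
  rfl

theorem inversions_eq_zero {w : List (Fin n)} (h : ∀ a ∈ w, ∀ b ∈ w, ¬ P.inc.Adj a b) :
    P.inversions w = 0 := by
  induction w with
  | nil => rfl
  | cons a w ih =>
    rw [inversions, ih fun b hb c hc => h b (by simp [hb]) c (by simp [hc]), add_zero, cross,
      List.countP_eq_zero]
    intro b hb
    simp [h a (by simp) b (by simp [hb])]

theorem cross_flatten (a : Fin n) (L : List (List (Fin n))) :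
    P.cross a L.flatten = (L.map (P.cross a)).sum := by
  induction L with
  | nil => rfl
  | cons w L ih => rw [List.flatten_cons, cross_append, ih, List.map_cons, List.sum_cons]

theorem inversions_flatten {m : ℕ} (L : Fin m → List (Fin n))
    (hL : ∀ i, P.inversions (L i) = 0) :
    P.inversions (List.ofFn L).flatten
      = ∑ i, ∑ j, if i < j then ((L i).map fun a => P.cross a (L j)).sum else 0 := by
  induction m with
  | zero => rfl
  | succ m ih =>
    rw [List.ofFn_succ, List.flatten_cons, inversions_append, hL, zero_add,
      ih (fun i => L i.succ) (fun i => hL i.succ), Fin.sum_univ_succ]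
    congr 1
    · rw [Fin.sum_univ_succ, if_neg (_root_.lt_irrefl _), zero_add]
      simp only [Fin.succ_pos, if_true, cross_flatten, List.map_ofFn, List.sum_ofFn,
        Function.comp_apply]
      generalize L 0 = w
      induction w with
      | nil => simp
      | cons a w ihw => simp [ihw, Finset.sum_add_distrib]
    · refine Finset.sum_congr rfl fun i _ => ?_
      rw [Fin.sum_univ_succ, if_neg (Fin.not_lt_zero _), zero_add]
      simp

open Classical in
theorem cross_sort (a : Fin n) (C : Finset (Fin n)) :
    P.cross a (C.sort (· ≥ ·)) = ∑ b, if b ∈ C ∧ b < a ∧ P.inc.Adj a b then 1 else 0 := by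
  rw [cross, ← Multiset.coe_countP, Finset.sort_eq, Multiset.countP_eq_card_filter,
    ← Finset.card_filter, Finset.card_def]
  congr 1
  rw [← Finset.filter_val]
  congr 1
  ext b
  simp

open Classical in
theorem inversions_chainWord {m : ℕ} (K : Fin m → Finset (Fin n))
    (hK : ∀ i, ∀ a ∈ K i, ∀ b ∈ K i, ¬ P.inc.Adj a b) :
    P.inversions (chainWord K) = ∑ i, ∑ j, ∑ a, ∑ b,
      if (i < j ∧ a ∈ K i ∧ b ∈ K j) ∧ b < a ∧ P.inc.Adj a b then 1 else 0 := by
  rw [chainWord, inversions_flatten]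
  · refine Finset.sum_congr rfl fun i _ => Finset.sum_congr rfl fun j _ => ?_
    split_ifs with hij
    · rw [map_sort_sum]
      refine (Finset.sum_congr (Finset.filter_univ_mem (K i)).symm fun _ _ => rfl).trans ?_
      rw [Finset.sum_filter]
      refine Finset.sum_congr rfl fun a _ => ?_
      rw [cross_sort]
      split_ifs with ha
      · exact Finset.sum_congr rfl fun b _ => if_congr (by tauto) rfl rfl
      · exact (Finset.sum_eq_zero fun b _ => if_neg fun h => ha h.1.2.1).symm
    · exact (Finset.sum_eq_zero fun a _ => Finset.sum_eq_zero fun b _ =>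
        if_neg fun h => hij h.1.1).symm
  · intro i
    refine P.inversions_eq_zero fun a ha b hb => hK i a ?_ b ?_
    · simpa using ha
    · simpa using hb

end NatUnitIntervalOrder

open Classical in
theorem coloringExponent_apply (κ : Fin n → Finset ℕ+) (r : ℕ+) :
    coloringExponent κ r = (Finset.univ.filter fun a => r ∈ κ a).card := by
  rw [coloringExponent, Finsupp.finsetSum_apply, Finset.card_filter]
  exact Finset.sum_congr rfl fun a _ => sum_single_one_apply _ _

theorem degree_coloringExponent (κ : Fin n → Finset ℕ+) :
    (coloringExponent κ).degree = ∑ a, (κ a).card := by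
  simp [coloringExponent, map_sum]

/-- The multi-coloring whose color classes are given by `K`. -/
def coloringOfClasses {m : ℕ} (c : Fin m ↪ ℕ+) (K : Fin m → Finset (Fin n)) (a : Fin n) :
    Finset ℕ+ :=
  (Finset.univ.filter fun i => a ∈ K i).map c

theorem mem_coloringOfClasses {m : ℕ} {c : Fin m ↪ ℕ+} {K : Fin m → Finset (Fin n)} {a : Fin n}
    {i : Fin m} : c i ∈ coloringOfClasses c K a ↔ a ∈ K i := by
  simp [coloringOfClasses]

open Classical in
theorem coloringAsc_coloringOfClasses (G : SimpleGraph (Fin n)) {m : ℕ} {c : Fin m ↪ ℕ+}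
    (hc : StrictAnti c) (K : Fin m → Finset (Fin n)) :
    coloringAsc G (coloringOfClasses c K) = ∑ i, ∑ j, ∑ a, ∑ b,
      if (i < j ∧ a ∈ K i ∧ b ∈ K j) ∧ b < a ∧ G.Adj a b then 1 else 0 := by
  have h1 : ∀ a b, (if G.Adj b a ∧ b < a then
        {p ∈ coloringOfClasses c K b ×ˢ coloringOfClasses c K a | p.1 < p.2}.card else 0)
      = ∑ i, ∑ j, if (i < j ∧ a ∈ K i ∧ b ∈ K j) ∧ b < a ∧ G.Adj a b then 1 else 0 := by
    intro a b
    split_ifs with hab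
    · rw [Finset.card_filter, Finset.sum_product_right, coloringOfClasses, Finset.sum_map,
        Finset.sum_filter]
      refine Finset.sum_congr rfl fun i _ => ?_
      rw [coloringOfClasses, Finset.sum_map, Finset.sum_filter]
      split_ifs with ha
      · refine Finset.sum_congr rfl fun j _ => ?_
        rw [← ite_and]
        refine if_congr ?_ rfl rfl
        have := hc.lt_iff_gt (a := j) (b := i)
        have := G.adj_comm a b
        tauto
      · exact (Finset.sum_eq_zero fun j _ => if_neg fun h => ha h.1.2.1).symm
    · refine (Finset.sum_eq_zero fun i _ => Finset.sum_eq_zero fun j _ => if_neg fun h => ?_).symm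
      exact hab ⟨h.2.2.symm, h.2.1⟩
  rw [coloringAsc, Finset.sum_comm]
  simp only [h1]
  simp only [← Finset.sum_product']
  exact Finset.sum_nbij' (fun x => (x.2.2.1, x.2.2.2, x.1, x.2.1))
    (fun x => (x.2.2.1, x.2.2.2, x.1, x.2.1)) (by simp) (by simp) (by simp) (by simp) (by simp)

/-- The coefficients of the chromatic quasisymmetric function are values of the functional that
counts inversions. -/
theorem coeff_chromaticQSym (μ : Fin n → ℕ) (s : ℕ+ →₀ ℕ) {m : ℕ} (c : Fin m ↪ ℕ+)
    (hc : StrictAnti c) (hs : Finset.univ.map c = s.support) :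
    MvPowerSeries.coeff s (chromaticQSym P.inc μ)
      = P.invFunctional μ (List.ofFn fun i => P.elem (s (c i))).prod := by
  classical
  have hrange : ∀ r, r ∈ s.support ↔ ∃ i, c i = r := by
    intro r
    rw [← hs]
    simp
  rw [P.prod_elem_eq_sum, map_sum]
  simp only [P.invFunctional_wordMonomial, NatUnitIntervalOrder.count_chainWord]
  rw [← Finset.sum_filter]
  symm
  refine Finset.sum_bij' (fun K _ => coloringOfClasses c K)
    (fun κ _ i => Finset.univ.filter fun a => c i ∈ κ a) ?_ ?_ ?_ ?_ ?_
  · intro K hK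
    rw [Finset.mem_filter, Fintype.mem_piFinset] at hK
    rw [mem_coloringsWithExponent]
    refine ⟨⟨fun a => ?_, fun a b hab => ?_⟩, ?_⟩
    · rw [coloringOfClasses, Finset.card_map, hK.2]
    · rw [Finset.disjoint_left]
      intro r hra hrb
      obtain ⟨i, hi, rfl⟩ := Finset.mem_map.mp hra
      exact (P.mem_chains.mp (hK.1 i)).2 a (mem_coloringOfClasses.mp hra) b
        (mem_coloringOfClasses.mp hrb) hab
    · ext r
      rw [coloringExponent_apply]
      by_cases hr : r ∈ s.support
      · obtain ⟨i, rfl⟩ := (hrange r).mp hr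
        simp only [mem_coloringOfClasses, Finset.filter_univ_mem]
        exact (P.mem_chains.mp (hK.1 i)).1
      · rw [Finsupp.notMem_support_iff.mp hr, Finset.card_eq_zero, Finset.filter_eq_empty_iff]
        intro a _ ha
        obtain ⟨i, _, hi⟩ := Finset.mem_map.mp ha
        exact hr ((hrange r).mpr ⟨i, hi⟩)
  · intro κ hκ
    rw [mem_coloringsWithExponent] at hκ
    rw [Finset.mem_filter, Fintype.mem_piFinset]
    refine ⟨fun i => P.mem_chains.mpr ⟨?_, ?_⟩, fun a => ?_⟩
    · rw [← coloringExponent_apply, hκ.2]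
    · intro a ha b hb hab
      rw [Finset.mem_filter] at ha hb
      exact Finset.disjoint_left.mp (hκ.1.2 a b hab) ha.2 hb.2
    · rw [← hκ.1.1 a, ← Finset.card_map c]
      congr 1
      ext r
      simp only [Finset.mem_map, Finset.mem_filter, Finset.mem_univ, true_and]
      constructor
      · rintro ⟨i, hi, rfl⟩
        exact hi
      · intro hr
        have : r ∈ s.support := by
          rw [Finsupp.mem_support_iff, ← hκ.2, coloringExponent_apply, Finset.card_ne_zero]
          exact ⟨a, by simpa using hr⟩
        obtain ⟨i, rfl⟩ := (hrange r).mp this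
        exact ⟨i, hr, rfl⟩
  · intro K _
    ext i a
    simp [mem_coloringOfClasses]
  · intro κ hκ
    rw [mem_coloringsWithExponent] at hκ
    ext a r
    constructor
    · intro hr
      obtain ⟨i, hi, rfl⟩ := Finset.mem_map.mp hr
      simpa using hi
    · intro hr
      have : r ∈ s.support := by
        rw [Finsupp.mem_support_iff, ← hκ.2, coloringExponent_apply, Finset.card_ne_zero]
        exact ⟨a, by simpa using hr⟩
      obtain ⟨i, rfl⟩ := (hrange r).mp this
      rw [mem_coloringOfClasses]
      simpa using hr
  · intro K hK
    rw [Finset.mem_filter, Fintype.mem_piFinset] at hK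
    rw [coloringAsc_coloringOfClasses _ hc,
      P.inversions_chainWord K fun i => (P.mem_chains.mp (hK.1 i)).2]

theorem coeff_chromaticQSym_eq_elemPart (μ : Fin n → ℕ) {d : ℕ} (s : ℕ+ →₀ ℕ) (l : d.Partition)
    (hl : s.support.val.map s = l.parts) :
    MvPowerSeries.coeff s (chromaticQSym P.inc μ) = P.invFunctional μ (P.elemPart l) := by
  classical
  let c : Fin s.support.card ↪ ℕ+ :=
    Fin.revPerm.toEmbedding.trans (s.support.orderEmbOfFin rfl).toEmbedding
  have hc : StrictAnti c := fun i j hij =>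
    (s.support.orderEmbOfFin rfl).strictMono (Fin.rev_lt_rev.mpr hij)
  have hs : Finset.univ.map c = s.support := by
    rw [← Finset.map_map, Finset.map_univ_equiv]
    exact Finset.map_orderEmbOfFin_univ s.support rfl
  rw [coeff_chromaticQSym P μ s c hc hs]
  refine P.invFunctional_congr μ ?_
  rw [NatUnitIntervalOrder.elemPart, map_list_prod, map_list_prod]
  refine List.Perm.prod_eq' (List.Perm.map _ ?_) ?_
  · have h1 : (List.ofFn fun i => P.elem (s (c i))) = (List.ofFn fun i => s (c i)).map P.elem := by
      rw [List.map_ofFn]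
      rfl
    rw [h1]
    refine List.Perm.map _ (Multiset.coe_eq_coe.mp ?_)
    have h2 := congrArg (fun t : Finset ℕ+ => t.val.map s) hs
    simp only [Finset.map_val, Fin.univ_val_map] at h2
    rw [Multiset.sort_eq, ← hl, ← h2, Multiset.map_coe, List.map_ofFn]
    rfl
  · rw [List.pairwise_map, List.pairwise_ofFn]
    exact fun i j _ => P.quot_elem_commute _ _

/-- The expansion of the chromatic quasisymmetric function into monomial symmetric functions. -/
theorem chromaticQSym_eq_sum_monoSymm (μ : Fin n → ℕ) :
    chromaticQSym P.inc μ = ∑ l : (∑ a, μ a).Partition,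
      P.invFunctional μ (P.elemPart l) • monoSymm ℕ+ (Polynomial ℚ) l := by
  classical
  ext s : 1
  rw [map_sum]
  simp only [MvPowerSeries.coeff_smul, coeff_monoSymm]
  by_cases hd : s.degree = ∑ a, μ a
  · rw [Finset.sum_eq_single (exponentPartition s hd)]
    · rw [if_pos (show s.support.val.map s = (exponentPartition s hd).parts from rfl), mul_one]
      exact coeff_chromaticQSym_eq_elemPart P μ s _ rfl
    · intro l _ hne
      rw [if_neg, mul_zero]
      intro h
      exact hne (Nat.Partition.ext h.symm)
    · simp
  · rw [Finset.sum_eq_zero]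
    · refine Finset.sum_eq_zero fun κ hκ => ?_
      rw [mem_coloringsWithExponent] at hκ
      refine absurd ?_ hd
      rw [← hκ.2, degree_coloringExponent]
      exact Finset.sum_congr rfl fun a _ => hκ.1.1 a
    · intro l _
      rw [if_neg, mul_zero]
      intro h
      apply hd
      refine Eq.trans ?_ l.parts_sum
      rw [← h]
      rfl

end ChromaticCoefficients

/-! ## Expansions into elementary symmetric functions -/

section ElementaryExpansion

variable (σ R : Type*) [CommRing R]

theorem map_elemSymmPart {d : ℕ} (l : d.Partition) :
    MvPowerSeries.map (Int.castRingHom R) (elemSymmPart σ ℤ l) = elemSymmPart σ R l := by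
  classical
  rw [elemSymmPart, elemSymmPart, map_multiset_prod, Multiset.map_map]
  congr 1
  refine Multiset.map_congr rfl fun k _ => ?_
  ext s
  rw [Function.comp_apply, MvPowerSeries.coeff_map, coeff_elemSymm, coeff_elemSymm]
  split_ifs <;> simp

theorem map_monoSymm {d : ℕ} (l : d.Partition) :
    MvPowerSeries.map (Int.castRingHom R) (monoSymm σ ℤ l) = monoSymm σ R l := by
  classical
  ext s
  rw [MvPowerSeries.coeff_map, coeff_monoSymm, coeff_monoSymm]
  split_ifs <;> simp

theorem monoSymm_eq_sum_smul [Infinite σ] {d : ℕ} (l : d.Partition) :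
    monoSymm σ R l = ∑ ν : d.Partition, (monoToElem l ν : R) • elemSymmPart σ R ν := by
  rw [← map_monoSymm, monoSymm_eq_sum, map_sum]
  refine Finset.sum_congr rfl fun ν _ => ?_
  rw [map_zsmul, map_elemSymmPart, Int.cast_smul_eq_zsmul]

theorem coeff_elemSymmPart_embDomain {d : ℕ} (e : Fin d ↪ σ) (l : d.Partition) (t : Fin d →₀ ℕ) :
    MvPowerSeries.coeff (t.embDomain e) (elemSymmPart σ R l)
      = ((MvPolynomial.coeff t (MvPolynomial.esymmPart (Fin d) ℤ l) : ℤ) : R) := by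
  have h : MvPowerSeries.killCompl e (elemSymmPart σ ℤ l)
      = ((MvPolynomial.esymmPart (Fin d) ℤ l : MvPolynomial (Fin d) ℤ) :
        MvPowerSeries (Fin d) ℤ) := by
    rw [elemSymmPart, MvPolynomial.esymmPart, map_multiset_prod, Multiset.map_map,
      ← MvPolynomial.coeToMvPowerSeries.ringHom_apply, map_multiset_prod, Multiset.map_map]
    congr 1
    refine Multiset.map_congr rfl fun k _ => ?_
    simp [killCompl_elemSymm, esymm_coe_eq_elemSymm]
  rw [← map_elemSymmPart, MvPowerSeries.coeff_map, ← MvPowerSeries.coeff_killCompl, h,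
    MvPolynomial.coeff_coe]
  rfl

theorem coeff_elemSymmPart_of_degree_ne {d : ℕ} (l : d.Partition) (s : σ →₀ ℕ)
    (hs : s.degree ≠ d) : MvPowerSeries.coeff s (elemSymmPart σ R l) = 0 := by
  rw [← map_elemSymmPart, MvPowerSeries.coeff_map, coeff_elemSymmPart_eq_zero l s hs, map_zero]

/-- The elementary symmetric functions are linearly independent. -/
theorem eq_zero_of_sum_elemSymmPart_eq_zero [Infinite σ] (c : (Σ d : ℕ, d.Partition) →₀ R)
    (hc : (c.sum fun l a => a • elemSymmPart σ R l.2) = 0) : c = 0 := by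
  classical
  ext ⟨d, l⟩
  let e : Fin d ↪ σ := Fin.valEmbedding.trans (Infinite.natEmbedding σ)
  have h1 : ∀ l' : d.Partition, ∑ ν : d.Partition, c ⟨d, ν⟩ * (elemToMono d ν l' : R) = 0 := by
    intro l'
    have h2 := congrArg (MvPowerSeries.coeff ((partVec l').embDomain e)) hc
    have hdeg : ((partVec l').embDomain e).degree = d := by
      rw [Finsupp.embDomain_eq_mapDomain, Finsupp.degree_mapDomain]
      refine Eq.trans ?_ l'.parts_sum
      rw [← support_map_partVec l']
      rfl
    rw [Finsupp.sum, map_sum, map_zero] at h2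
    rw [← h2]
    refine Finset.sum_bij_ne_zero (fun ν _ _ => ⟨d, ν⟩) ?_ ?_ ?_ ?_
    · intro ν _ hν
      rw [Finsupp.mem_support_iff]
      exact left_ne_zero_of_mul hν
    · intro ν _ _ ν' _ _ h
      exact sigma_mk_injective h
    · rintro ⟨d', ν⟩ _ hν
      rw [MvPowerSeries.coeff_smul] at hν
      obtain rfl : d = d' := by
        by_contra hne
        refine hν ?_
        rw [coeff_elemSymmPart_of_degree_ne σ R ν _ (hdeg.symm ▸ hne), mul_zero]
      refine ⟨ν, Finset.mem_univ _, ?_, rfl⟩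
      rwa [coeff_elemSymmPart_embDomain] at hν
    · intro ν _ _
      rw [MvPowerSeries.coeff_smul, coeff_elemSymmPart_embDomain]
      rfl
  have h3 : ∑ l' : d.Partition, (∑ ν : d.Partition, c ⟨d, ν⟩ * (elemToMono d ν l' : R))
      * (monoToElem l' l : R) = 0 :=
    Finset.sum_eq_zero fun l' _ => by rw [h1, zero_mul]
  have h4 : ∀ ν : d.Partition, ∑ l' : d.Partition, (elemToMono d ν l' : R) * (monoToElem l' l : R)
      = if ν = l then 1 else 0 := by
    intro ν
    have := congrFun (congrFun (elemToMono_mul_monoToElem d) ν) l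
    rw [Matrix.mul_apply, Matrix.one_apply] at this
    have h5 := congrArg (Int.cast : ℤ → R) this
    rw [Int.cast_sum] at h5
    simpa using! h5
  simp only [Finset.sum_mul, mul_assoc] at h3
  rw [Finset.sum_comm] at h3
  simp only [← Finset.mul_sum, h4] at h3
  simpa using h3

end ElementaryExpansion

section MainTheorem

variable {n : ℕ} (P : NatUnitIntervalOrder n)

/-- The coefficients of the expansion of the chromatic quasisymmetric function into elementary
symmetric functions. -/
noncomputable def chromaticCoeff (μ : Fin n → ℕ) (ν : (∑ a, μ a).Partition) : Polynomial ℚ :=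
  ∑ l : (∑ a, μ a).Partition, P.invFunctional μ (P.elemPart l) * (monoToElem l ν : Polynomial ℚ)

theorem chromaticCoeff_eq (μ : Fin n → ℕ) (ν : (∑ a, μ a).Partition) :
    chromaticCoeff P μ ν = P.invFunctional μ (P.monomial ν) := by
  rw [NatUnitIntervalOrder.monomial, map_sum]
  refine Finset.sum_congr rfl fun l _ => ?_
  rw [map_zsmul, zsmul_eq_mul, monoToElem_symm, mul_comm]

theorem chromaticQSym_eq_sum_elemSymmPart (μ : Fin n → ℕ) :
    chromaticQSym P.inc μ = ∑ ν : (∑ a, μ a).Partition,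
      chromaticCoeff P μ ν • elemSymmPart ℕ+ (Polynomial ℚ) ν := by
  rw [chromaticQSym_eq_sum_monoSymm]
  simp only [monoSymm_eq_sum_smul, Finset.smul_sum, smul_smul, chromaticCoeff, Finset.sum_smul]
  exact Finset.sum_comm

/-- The expansion of the chromatic quasisymmetric function into elementary symmetric functions, as
a finitely supported function. -/
noncomputable def chromaticExpansion (μ : Fin n → ℕ) :
    (Σ d : ℕ, d.Partition) →₀ Polynomial ℚ :=
  ∑ ν : (∑ a, μ a).Partition, Finsupp.single ⟨_, ν⟩ (chromaticCoeff P μ ν)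

theorem sum_sum_single {ι κ R M : Type*} [Fintype κ] [Semiring R] [AddCommMonoid M] [Module R M]
    (g : κ → ι) (c : κ → R) (f : ι → M) :
    ((∑ k, Finsupp.single (g k) (c k)).sum fun l a => a • f l) = ∑ k, c k • f (g k) := by
  rw [← Finsupp.linearCombination_apply R, map_sum]
  exact Finset.sum_congr rfl fun k _ => Finsupp.linearCombination_single R _ _

theorem chromaticQSym_eq_sum_chromaticExpansion (μ : Fin n → ℕ) :
    chromaticQSym P.inc μ
      = (chromaticExpansion P μ).sum fun l a => a • elemSymmPart ℕ+ (Polynomial ℚ) l.2 := by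
  rw [chromaticQSym_eq_sum_elemSymmPart, chromaticExpansion,
    sum_sum_single (fun ν : (∑ a, μ a).Partition => (⟨_, ν⟩ : Σ d : ℕ, d.Partition))
      (chromaticCoeff P μ) fun l => elemSymmPart ℕ+ (Polynomial ℚ) l.2]

theorem eq_chromaticExpansion (μ : Fin n → ℕ) (c : (Σ d : ℕ, d.Partition) →₀ Polynomial ℚ)
    (hc : chromaticQSym P.inc μ = c.sum fun l a => a • elemSymmPart ℕ+ (Polynomial ℚ) l.2) :
    c = chromaticExpansion P μ := by
  rw [← sub_eq_zero]
  refine eq_zero_of_sum_elemSymmPart_eq_zero ℕ+ (Polynomial ℚ) _ ?_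
  rw [Finsupp.sum_sub_index fun _ _ _ => sub_smul _ _ _, ← hc,
    ← chromaticQSym_eq_sum_chromaticExpansion, sub_self]

open Classical in
theorem sum_chromaticExpansion (μ : Fin n → ℕ) (k : ℕ) :
    ∑ l ∈ (chromaticExpansion P μ).support with l.2.parts.card = k, chromaticExpansion P μ l
      = ∑ ν : (∑ a, μ a).Partition with ν.parts.card = k, chromaticCoeff P μ ν := by
  have h : ∀ c : (Σ d : ℕ, d.Partition) →₀ Polynomial ℚ,
      ∑ l ∈ c.support with l.2.parts.card = k, c l
        = c.sum fun l a => if l.2.parts.card = k then a else 0 := by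
    intro c
    rw [Finset.sum_filter]
    rfl
  rw [h, chromaticExpansion, ← Finsupp.sum_finsetSum_index, Finset.sum_filter]
  · refine Finset.sum_congr rfl fun ν _ => ?_
    rw [Finsupp.sum_single_index]
    simp
  · simp
  · intro l a b
    split_ifs <;> simp

open Classical in
theorem quot_sum_heaps (d k : ℕ) :
    P.quot (∑ μ ∈ Finset.piAntidiag (Finset.univ : Finset (Fin n)) d,
        ∑ H : Heap P μ with H.numSinks = k, wordMonomial H.word)
      = ∑ w ∈ P.normalWords d with P.sinkCount n w = k, wordEval P.gen w := by
  have h1 : ∀ μ ∈ Finset.piAntidiag (Finset.univ : Finset (Fin n)) d,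
      P.quot (∑ H : Heap P μ with H.numSinks = k, wordMonomial H.word)
        = ∑ w ∈ (P.normalWords d).filter (fun w => P.sinkCount n w = k) with
            (fun a => w.count a) = μ, wordEval P.gen w := by
    intro μ hμ
    rw [Finset.mem_piAntidiag] at hμ
    rw [Heap.sum_heaps d k hμ.1, map_sum]
    refine Finset.sum_congr ?_ fun w _ => P.quot_wordMonomial w
    ext w
    simp only [Finset.mem_filter, funext_iff, and_assoc]
  rw [map_sum, Finset.sum_congr rfl h1]
  refine Finset.sum_fiberwise_of_maps_to (fun w hw => ?_) _
  rw [Finset.mem_filter, NatUnitIntervalOrder.mem_normalWords] at hw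
  rw [Finset.mem_piAntidiag]
  refine ⟨?_, fun _ _ => Finset.mem_univ _⟩
  rw [← hw.1.1, ← sum_count_eq_length]

open Classical in
theorem sum_chromaticCoeff (μ : Fin n → ℕ) (k : ℕ) :
    ∑ ν : (∑ a, μ a).Partition with ν.parts.card = k, chromaticCoeff P μ ν
      = ∑ H : Heap P μ with H.numSinks = k, Polynomial.X ^ H.asc := by
  have h1 : P.invFunctional μ (∑ ν : (∑ a, μ a).Partition with ν.parts.card = k, P.monomial ν)
      = P.invFunctional μ
        (∑ w ∈ P.normalWords (∑ a, μ a) with P.sinkCount n w = k, wordMonomial w) := by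
    refine P.invFunctional_congr μ ?_
    rw [map_sum, P.sum_quot_monomial, map_sum]
    exact Finset.sum_congr rfl fun w _ => (P.quot_wordMonomial w).symm
  rw [map_sum, map_sum] at h1
  simp only [chromaticCoeff_eq]
  rw [h1]
  simp only [Heap.asc_eq]
  rw [Heap.sum_heaps _ k rfl fun w => (Polynomial.X ^ P.inversions w : Polynomial ℚ)]
  simp only [P.invFunctional_wordMonomial]
  rw [← Finset.sum_filter, Finset.filter_filter]

end MainTheorem

open Classical in
theorem mainTheorem6 {n : ℕ} (P : NatUnitIntervalOrder n) (k : ℕ) (hk : 1 ≤ k) :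
    (∀ d : ℕ, 1 ≤ d →
      (∑ l : d.Partition with l.parts.card = k, P.monomial l)
        - (∑ μ ∈ Finset.piAntidiag (Finset.univ : Finset (Fin n)) d,
            ∑ H : Heap P μ with H.numSinks = k, wordMonomial H.word) ∈ P.ideal) ∧
    ∀ μ : Fin n → ℕ,
      (∃! c : (Σ d : ℕ, d.Partition) →₀ Polynomial ℚ,
        chromaticQSym P.inc μ
          = c.sum fun l a => a • elemSymmPart ℕ+ (Polynomial ℚ) l.2) ∧
      ∀ c : (Σ d : ℕ, d.Partition) →₀ Polynomial ℚ,
        chromaticQSym P.inc μ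
          = (c.sum fun l a => a • elemSymmPart ℕ+ (Polynomial ℚ) l.2) →
        ∑ l ∈ c.support with l.2.parts.card = k, c l
          = ∑ H : Heap P μ with H.numSinks = k, Polynomial.X ^ H.asc := by
  refine ⟨fun d _ => ?_, fun μ => ⟨⟨chromaticExpansion P μ,
    chromaticQSym_eq_sum_chromaticExpansion P μ, eq_chromaticExpansion P μ⟩, fun c hc => ?_⟩⟩
  · rw [← P.quot_eq_zero_iff, map_sub, map_sum, P.sum_quot_monomial, quot_sum_heaps, sub_self]
  · obtain rfl := eq_chromaticExpansion P μ c hc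
    rw [sum_chromaticExpansion, sum_chromaticCoeff]
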